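/- For a real matrix $M$ with $k$ columns, call $M$ a minimal linear dependency if there is $x\in\mathbb R^k$ with $Mx=0$ and all $k$ coordinates of $x$ nonzero, and $\operatorname{rank}(M)=k-1$. Let $\mathcal T_k$ (tree dependencies) be the set of $\{0,1\}$-matrices with $k$ columns and exactly $2k-2$ ones whose nonzero rows form the edge-vertex incidence matrix of a tree on $k$ vertices (rows indexed by edges, columns by vertices). For a matrix $M$ and a set $S$ of its columns, $M_S$ is the submatrix of $M$ formed by the columns in $S$ (and all rows). Let $p=p(n)\in[0,1]$ satisfy $np\to\infty$ as $n\to\infty$ and $p\le 1/2$, and let $B\sim\mathbb B(n,p)$, that is, $B$ is an $n\times n$ random matrix with independent entries, each equal to $1$ with probability $p$ and to $0$ otherwise. Then, with probability tending to $1$ as $n\to\infty$, at least one of the following holds: 1. for all $k$ and all sets $S$ of $k$ columns of $B$, if $B_S$ is a minimal linear dependency then $B_S\in\mathcal T_k$; 2. for all $k$ and all sets $S$ of $k$ columns of $B^\top$, if $(B^\top)_S$ is a minimal linear dependency then $(B^\top)_S\in\mathcal T_k$. -/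

import Mathlib

open MeasureTheory ProbabilityTheory Filter Topology

namespace SparseRank

noncomputable section

/-- The law `𝔹(n, p)` of the `n²` independent Bernoulli(`p`) entries of a random matrix,
an entry `true` (value `1`) having probability `p`. -/
def bernoulliLaw (n : ℕ) (p : unitInterval) : Measure (Fin n × Fin n → Bool) :=
  Measure.pi fun _ => bernoulliMeasure true false p

/-- The real `{0,1}`-matrix with the given pattern of ones. -/
def zeroOneMatrix {n : ℕ} (b : Fin n × Fin n → Bool) : Matrix (Fin n) (Fin n) ℝ :=
  Matrix.of fun i j => if b (i, j) = true then 1 else 0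

/-- The submatrix of `M` formed by all rows and by the columns indexed by `S`. -/
def columns {ι κ : Type*} (M : Matrix ι κ ℝ) (S : Finset κ) : Matrix ι S ℝ :=
  M.submatrix id (fun j : S => (j : κ))

/-- A matrix with `k` columns is a minimal linear dependency if its kernel has a vector all of
whose `k` coordinates are nonzero, and its rank is `k - 1`. -/
def IsMinimalDependency {ι κ : Type*} [Fintype κ] (k : ℕ) (M : Matrix ι κ ℝ) : Prop :=
  Fintype.card κ = k ∧ (∃ x : κ → ℝ, M.mulVec x = 0 ∧ ∀ j, x j ≠ 0) ∧ M.rank + 1 = k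

/-- The class `𝒯ₖ` of tree dependencies: `{0,1}`-matrices with `k` columns and exactly `2k - 2`
ones whose nonzero rows form the edge-vertex incidence matrix (rows are edges, columns are
vertices) of a tree on the `k` columns. -/
def IsTreeDependency {ι κ : Type*} [Fintype κ] (k : ℕ) (M : Matrix ι κ ℝ) : Prop :=
  Fintype.card κ = k ∧
  (∀ i j, M i j = 0 ∨ M i j = 1) ∧
  {q : ι × κ | M q.1 q.2 = 1}.encard + 2 = 2 * (k : ℕ∞) ∧
  ∃ T : SimpleGraph κ, T.IsTree ∧
    ∃ e : {i : ι // M i ≠ 0} ≃ T.edgeSet,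
      ∀ (i : {i : ι // M i ≠ 0}) (j : κ), M i j = 1 ↔ j ∈ (e i : Sym2 κ)

/-- For every `k`, all minimal dependencies of `k` columns of `M` are tree dependencies. -/
def MinimalDependenciesAreTrees {n : ℕ} (M : Matrix (Fin n) (Fin n) ℝ) : Prop :=
  ∀ (k : ℕ) (S : Finset (Fin n)), S.card = k →
    IsMinimalDependency k (columns M S) → IsTreeDependency k (columns M S)

end

end SparseRank

namespace SparseRank

noncomputable section

/-! Write `d = n * p` and sort minimal dependencies by the size `k` of their column set `S`. A row
with exactly one 1 in `S` would force a kernel coordinate to vanish, so no row meets `S` in one 1.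

If `k * p ≤ 1/2`, there are at least `k - 1` nonzero rows in `S`, each with at least two ones. A
non-tree has one more such row, or a row with three ones (`IsMinimalDependency.excess`). This excess
supplies the factor of `p` that a tree lacks in the first-moment count, which becomes a convergent
series with ratio of order `d ^ 2 * exp (-d / 4)` (`mass_excessEvent_le`).

If `1/2 ≤ k * p ≤ M`, each row avoids having one 1 with probability bounded away from 1, and only
`exp (o(n))` sets `S` are this small (`mass_moderate_le`).

If `M ≤ k * p` and `k ≤ n / 2`, some `k - 1` rows determine the kernel, and each of the remaining
rows, at least half of all, must annihilate a vector fixed by them. The Littlewood–Offord bound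
`mass_rowDot_le` makes this beat the `4 ^ n` choices of column and row sets (`mass_largeEvent_le`).

For `k > n / 2` the alternative between `B` and its transpose enters. If both have such
dependencies, then more than half of the rows are combinations of the other rows, and hence
annihilate a widely supported vector determined by those other rows. Each row does so with small
probability, and double counting over rows finishes (`mass_hugeEvent_inter_le`). -/

/-- The total weight of a set in a finite type. -/
def mass {Ω : Type*} [Fintype Ω] (W : Ω → ℝ) (A : Set Ω) : ℝ := ∑ ω, A.indicator W ω

/-- The product weight on functions. -/
def prodWeight {ι Ω : Type*} [Fintype ι] (W : Ω → ℝ) (f : ι → Ω) : ℝ := ∏ i, W (f i)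

/-! ### Finite weighted probability: union bounds, products, conditioning. -/

section Mass

variable {Ω : Type*} [Fintype Ω] {W : Ω → ℝ}

lemma mass_nonneg (hW : ∀ ω, 0 ≤ W ω) (A : Set Ω) : 0 ≤ mass W A :=
  Finset.sum_nonneg fun ω _ => Set.indicator_nonneg (fun ω _ => hW ω) ω

lemma mass_mono (hW : ∀ ω, 0 ≤ W ω) {A B : Set Ω} (h : A ⊆ B) : mass W A ≤ mass W B :=
  Finset.sum_le_sum fun ω _ => Set.indicator_le_indicator_of_subset h hW ω

lemma mass_empty : mass W ∅ = 0 := by simp [mass]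

lemma mass_univ : mass W Set.univ = ∑ ω, W ω := by simp [mass]

lemma mass_add_compl (A : Set Ω) : mass W A + mass W Aᶜ = ∑ ω, W ω := by
  rw [mass, mass, ← Finset.sum_add_distrib]
  exact Finset.sum_congr rfl fun ω _ => Set.indicator_self_add_compl_apply A W ω

lemma mass_le_sum (hW : ∀ ω, 0 ≤ W ω) {κ : Type*} (s : Finset κ) {A : Set Ω} (B : κ → Set Ω)
    (h : ∀ ω ∈ A, ∃ i ∈ s, ω ∈ B i) : mass W A ≤ ∑ i ∈ s, mass W (B i) := by
  unfold mass
  rw [Finset.sum_comm]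
  refine Finset.sum_le_sum fun ω _ => ?_
  have h0 : ∀ i ∈ s, 0 ≤ (B i).indicator W ω := fun i _ =>
    Set.indicator_nonneg (fun ω _ => hW ω) ω
  by_cases hω : ω ∈ A
  · obtain ⟨i, hi, hB⟩ := h ω hω
    calc A.indicator W ω = (B i).indicator W ω := by simp [hω, hB]
      _ ≤ _ := Finset.single_le_sum (f := fun i => (B i).indicator W ω) h0 hi
  · simpa [hω] using Finset.sum_nonneg h0

lemma mass_union_le (hW : ∀ ω, 0 ≤ W ω) (A B : Set Ω) :
    mass W (A ∪ B) ≤ mass W A + mass W B := by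
  simpa [Bool.forall_bool, add_comm] using mass_le_sum hW (Finset.univ : Finset Bool)
    (A := A ∪ B) (fun b => if b then A else B) (by rintro ω (h | h) <;> simp [h])

lemma sum_mass_le (hW : ∀ ω, 0 ≤ W ω) {κ : Type*} (s : Finset κ) {A : Set Ω} (B : κ → Set Ω)
    (hB : ∀ i ∈ s, B i ⊆ A) (hd : ∀ ω, ∀ i ∈ s, ∀ j ∈ s, ω ∈ B i → ω ∈ B j → i = j) :
    ∑ i ∈ s, mass W (B i) ≤ mass W A := by
  unfold mass
  rw [Finset.sum_comm]
  refine Finset.sum_le_sum fun ω _ => ?_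
  by_cases hω : ∃ i ∈ s, ω ∈ B i
  · obtain ⟨i, hi, h⟩ := hω
    rw [Finset.sum_eq_single_of_mem i hi]
    · simp [h, hB i hi h]
    · intro j hj hji
      exact Set.indicator_of_notMem (fun h' => hji (hd ω j hj i hi h' h)) _
  · push Not at hω
    rw [Finset.sum_eq_zero fun i hi => Set.indicator_of_notMem (hω i hi) _]
    exact Set.indicator_nonneg (fun ω _ => hW ω) ω

/-- Double counting: every point of `A` is counted at least `c` times on the right. -/
lemma mul_mass_le_sum (hW : ∀ ω, 0 ≤ W ω) {κ : Type*} [Fintype κ] {A : Set Ω} (B : κ → Set Ω)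
    (c : ℝ) (h : ∀ ω ∈ A, ∃ s : Finset κ, c ≤ s.card ∧ ∀ i ∈ s, ω ∈ B i) :
    c * mass W A ≤ ∑ i, mass W (B i) := by
  unfold mass
  rw [Finset.sum_comm, Finset.mul_sum]
  refine Finset.sum_le_sum fun ω _ => ?_
  have h0 : ∀ i, 0 ≤ (B i).indicator W ω := fun i => Set.indicator_nonneg (fun ω _ => hW ω) ω
  by_cases hω : ω ∈ A
  · obtain ⟨s, hs, hB⟩ := h ω hω
    calc c * A.indicator W ω ≤ s.card * W ω := by
          simpa [hω] using mul_le_mul_of_nonneg_right hs (hW ω)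
      _ = ∑ i ∈ s, (B i).indicator W ω := by
          rw [Finset.sum_congr rfl fun i hi => Set.indicator_of_mem (hB i hi) W]; simp
      _ ≤ _ := Finset.sum_le_univ_sum_of_nonneg h0
  · simpa [hω] using Finset.sum_nonneg fun i _ => h0 i

variable {ι : Type*} [Fintype ι]

omit [Fintype Ω] in
lemma prodWeight_nonneg (hW : ∀ ω, 0 ≤ W ω) (f : ι → Ω) : 0 ≤ prodWeight W f :=
  Finset.prod_nonneg fun _ _ => hW _

variable [DecidableEq ι]

lemma mass_pi (X : ι → Set Ω) :
    mass (prodWeight W) {f : ι → Ω | ∀ i, f i ∈ X i} = ∏ i, mass W (X i) := by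
  classical
  unfold mass
  rw [Finset.prod_univ_sum, Fintype.piFinset_univ]
  refine Finset.sum_congr rfl fun f _ => ?_
  by_cases h : ∀ i, f i ∈ X i
  · rw [Set.indicator_of_mem (by exact h), prodWeight]
    exact Finset.prod_congr rfl fun i _ => (Set.indicator_of_mem (h i) _).symm
  · rw [Set.indicator_of_notMem (by exact h)]
    push Not at h
    obtain ⟨i, hi⟩ := h
    exact (Finset.prod_eq_zero (Finset.mem_univ i) (Set.indicator_of_notMem hi _)).symm

lemma sum_prodWeight : ∑ f : ι → Ω, prodWeight W f = (∑ ω, W ω) ^ Fintype.card ι := by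
  rw [← mass_univ, ← mass_univ]
  simpa [mass_univ] using mass_pi (W := W) (fun _ : ι => Set.univ)

lemma sum_prodWeight_eq_one (h1 : ∑ ω, W ω = 1) : ∑ f : ι → Ω, prodWeight W f = 1 := by
  rw [sum_prodWeight, h1, one_pow]

/-- Fubini: a bound that holds conditionally on the coordinates outside `P` holds on average. -/
lemma mass_le_of_split (hW : ∀ ω, 0 ≤ W ω) (h1 : ∑ ω, W ω = 1) (P : ι → Prop) [DecidablePred P]
    (A : Set (ι → Ω)) {c : ℝ}
    (h : ∀ g : {i // ¬ P i} → Ω, mass (prodWeight W)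
      {f : {i // P i} → Ω | (fun i => if hi : P i then f ⟨i, hi⟩ else g ⟨i, hi⟩) ∈ A} ≤ c) :
    mass (prodWeight W) A ≤ c := by
  classical
  have key : mass (prodWeight W) A = ∑ g : {i // ¬ P i} → Ω, prodWeight W g *
      mass (prodWeight W)
        {f : {i // P i} → Ω | (fun i => if hi : P i then f ⟨i, hi⟩ else g ⟨i, hi⟩) ∈ A} := by
    unfold mass
    simp_rw [Finset.mul_sum]
    rw [Finset.sum_comm, ← Fintype.sum_prod_type',
      ← Equiv.sum_comp (Equiv.piEquivPiSubtypeProd P fun _ => Ω).symm]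
    refine Finset.sum_congr rfl fun fg _ => ?_
    obtain ⟨f, g⟩ := fg
    have hw : prodWeight W ((Equiv.piEquivPiSubtypeProd P fun _ => Ω).symm (f, g)) =
        prodWeight W g * prodWeight W f := by
      unfold prodWeight
      rw [← Fintype.prod_subtype_mul_prod_subtype P, mul_comm]
      congr 1
      · exact Finset.prod_congr rfl fun i _ => by
          simp [Equiv.piEquivPiSubtypeProd, i.2]
      · exact Finset.prod_congr rfl fun i _ => by
          simp [Equiv.piEquivPiSubtypeProd, i.2]
    by_cases hA : (Equiv.piEquivPiSubtypeProd P fun _ => Ω).symm (f, g) ∈ A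
    · rw [Set.indicator_of_mem hA, hw, Set.indicator_of_mem (by exact hA)]
    · rw [Set.indicator_of_notMem hA, Set.indicator_of_notMem (by exact hA), mul_zero]
  rw [key]
  calc _ ≤ ∑ g : {i // ¬ P i} → Ω, prodWeight W g * c :=
        Finset.sum_le_sum fun g _ => mul_le_mul_of_nonneg_left (h g) (prodWeight_nonneg hW g)
    _ = c := by rw [← Finset.sum_mul, sum_prodWeight_eq_one h1, one_mul]

/-- Once the coordinates in `R` are revealed, `X f` is a fixed set, and the remaining independent
coordinates must all fall into it. -/
lemma mass_le_pow_of_dependent (hW : ∀ ω, 0 ≤ W ω) (h1 : ∑ ω, W ω = 1) (R : Finset ι)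
    (X : (ι → Ω) → Set Ω) (hX : ∀ f f', (∀ i ∈ R, f i = f' i) → X f = X f') {c : ℝ}
    (hc : ∀ f, mass W (X f) ≤ c) :
    mass (prodWeight W) {f : ι → Ω | ∀ i ∉ R, f i ∈ X f} ≤ c ^ (Fintype.card ι - R.card) := by
  classical
  rcases isEmpty_or_nonempty Ω with hΩ | ⟨⟨ω₀⟩⟩
  · simp at h1
  refine mass_le_of_split hW h1 (fun i => i ∉ R) _ fun g => ?_
  set F : ι → Ω := fun i => if hi : i ∉ R then ω₀ else g ⟨i, hi⟩ with hF
  calc _ ≤ mass (prodWeight W) {f : {i // i ∉ R} → Ω | ∀ i, f i ∈ X F} := by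
        refine mass_mono (prodWeight_nonneg hW) fun f hf i => ?_
        have := hf i.1 i.2
        simp only [i.2, not_false_eq_true, dite_true] at this
        rw [hX _ F] at this
        · exact this
        · intro j hj
          simp [hF, hj]
    _ = ∏ i : {i // i ∉ R}, mass W (X F) := mass_pi _
    _ = mass W (X F) ^ (Fintype.card ι - R.card) := by
        simp [Fintype.card_subtype_compl]
    _ ≤ _ := pow_le_pow_left₀ (mass_nonneg hW _) (hc F) _

end Mass

/-! ### The Bernoulli matrix law as a product weight. -/

/-- The weight of a Bernoulli variable. -/
def bernoulliWeight (p : ℝ) (b : Bool) : ℝ := if b then p else 1 - p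

lemma bernoulliWeight_nonneg {p : ℝ} (h0 : 0 ≤ p) (h1 : p ≤ 1) (b : Bool) :
    0 ≤ bernoulliWeight p b := by
  unfold bernoulliWeight; split_ifs <;> linarith

lemma sum_bernoulliWeight (p : ℝ) : ∑ b, bernoulliWeight p b = 1 := by
  simp [bernoulliWeight]

/-- The weight of a row of independent Bernoulli entries. -/
abbrev rowWeight (κ : Type*) [Fintype κ] (p : ℝ) : (κ → Bool) → ℝ :=
  prodWeight (bernoulliWeight p)

/-- The weight of a matrix of independent Bernoulli entries. -/
abbrev matrixWeight (ι κ : Type*) [Fintype ι] [Fintype κ] (p : ℝ) : (ι → κ → Bool) → ℝ :=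
  prodWeight (rowWeight κ p)

lemma bernoulliLaw_real_eq_mass (n : ℕ) (p : unitInterval) (A : Set (Fin n × Fin n → Bool)) :
    (bernoulliLaw n p).real A =
      mass (matrixWeight (Fin n) (Fin n) p) {f | (fun q => f q.1 q.2) ∈ A} := by
  classical
  have hb : ∀ b : Bool, bernoulliMeasure true false p {b} =
      ENNReal.ofReal (bernoulliWeight p b) := by
    intro b
    cases b <;> simp [bernoulliWeight, ENNReal.ofReal]
    · ext
      simp [unitInterval.toNNReal, sub_nonneg.2 p.2.2]
      rfl
    · ext
      simp [unitInterval.toNNReal, p.2.1]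
      rfl
  have hs : ∀ b : Fin n × Fin n → Bool,
      (bernoulliLaw n p).real {b} = ∏ q, bernoulliWeight p (b q) := by
    intro b
    rw [measureReal_def, bernoulliLaw, Measure.pi_singleton, ENNReal.toReal_prod]
    refine Finset.prod_congr rfl fun q _ => ?_
    rw [hb, ENNReal.toReal_ofReal (bernoulliWeight_nonneg p.2.1 p.2.2 _)]
  have : IsProbabilityMeasure (bernoulliLaw n p) := by unfold bernoulliLaw; infer_instance
  have hA : (bernoulliLaw n p).real A = mass (fun b => ∏ q, bernoulliWeight p (b q)) A := by
    rw [← Set.coe_toFinset A, ← sum_measureReal_singleton, mass]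
    simp_rw [hs, Set.indicator_apply, Set.coe_toFinset]
    rw [← Finset.sum_filter]
    refine Finset.sum_congr (by ext; simp) fun _ _ => rfl
  rw [hA, mass, mass, ← Equiv.sum_comp (Equiv.curry (Fin n) (Fin n) Bool)]
  refine Finset.sum_congr rfl fun b _ => ?_
  have hw : ∏ q, bernoulliWeight p (b q) =
      matrixWeight (Fin n) (Fin n) p (Equiv.curry (Fin n) (Fin n) Bool b) := by
    rw [Fintype.prod_prod_type]; rfl
  by_cases h : b ∈ A
  · rw [Set.indicator_of_mem h, Set.indicator_of_mem (by exact h), hw]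
  · rw [Set.indicator_of_notMem h, Set.indicator_of_notMem (by exact h)]

lemma mass_transpose {ι : Type*} [Fintype ι] [DecidableEq ι] (p : ℝ) (A : Set (ι → ι → Bool)) :
    mass (matrixWeight ι ι p) {f | (fun i j => f j i) ∈ A} = mass (matrixWeight ι ι p) A := by
  rw [mass, mass, ← Equiv.sum_comp (Equiv.piComm fun _ _ : ι => Bool)]
  refine Finset.sum_congr rfl fun f _ => ?_
  have hw : matrixWeight ι ι p (Equiv.piComm (fun _ _ : ι => Bool) f) = matrixWeight ι ι p f := by
    simp only [matrixWeight, rowWeight, prodWeight]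
    exact Finset.prod_comm
  by_cases h : f ∈ A
  · rw [Set.indicator_of_mem h, Set.indicator_of_mem (by exact h), hw]
  · rw [Set.indicator_of_notMem h, Set.indicator_of_notMem (by exact h)]

/-! ### Anti-concentration: binomial probabilities and Littlewood–Offord. -/

/-- The binomial probabilities. -/
def binomialTerm (m : ℕ) (p : ℝ) (j : ℕ) : ℝ := m.choose j * p ^ j * (1 - p) ^ (m - j)

lemma binomialTerm_nonneg {p : ℝ} (h0 : 0 ≤ p) (h1 : p ≤ 1) (m j : ℕ) :
    0 ≤ binomialTerm m p j := by
  have : 0 ≤ 1 - p := by linarith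
  unfold binomialTerm; positivity

lemma sum_binomialTerm (m : ℕ) (p : ℝ) : ∑ j ∈ Finset.range (m + 1), binomialTerm m p j = 1 := by
  have := add_pow p (1 - p) m
  rw [add_sub_cancel, one_pow] at this
  rw [this]
  exact Finset.sum_congr rfl fun j _ => by unfold binomialTerm; ring

lemma binomialTerm_succ_mul (m : ℕ) (p : ℝ) (j : ℕ) (hj : j < m) :
    binomialTerm m p (j + 1) * ((j + 1) * (1 - p)) = binomialTerm m p j * ((m - j) * p) := by
  have h := Nat.choose_succ_right_eq m j
  have h' : (m.choose (j + 1) : ℝ) * (j + 1) = m.choose j * (m - j) := by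
    rw [← Nat.cast_sub hj.le]; exact_mod_cast h
  have e : m - j = (m - (j + 1)) + 1 := by omega
  unfold binomialTerm
  rw [e, pow_succ, pow_succ]
  linear_combination p ^ j * p * (1 - p) ^ (m - (j + 1)) * (1 - p) * h'

lemma sum_binomialTerm_le_one {p : ℝ} (h0 : 0 ≤ p) (h1 : p ≤ 1) (m : ℕ) (s : Finset ℕ)
    (hs : ∀ j ∈ s, j ≤ m) : ∑ j ∈ s, binomialTerm m p j ≤ 1 := by
  rw [← sum_binomialTerm m p]
  refine Finset.sum_le_sum_of_subset_of_nonneg (fun j hj => ?_)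
    fun j _ _ => binomialTerm_nonneg h0 h1 m j
  simpa [Nat.lt_succ_iff] using hs j hj

/-- The binomial probabilities are uniformly small when the mean is large. -/
lemma binomialTerm_le {ε : ℝ} (hε : 0 < ε) : ∃ M : ℝ, 0 < M ∧ ∀ (m : ℕ) (p : ℝ), 0 ≤ p →
    p ≤ 1 / 2 → M ≤ m * p → ∀ j, binomialTerm m p j ≤ ε := by
  obtain ⟨L, hL⟩ := exists_nat_gt (2 / ε)
  have hL0 : 0 < (L : ℝ) := lt_trans (by positivity) hL
  have hL1 : (1 : ℝ) ≤ L := by exact_mod_cast (Nat.cast_pos.1 hL0)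
  -- With this mean, the `L` terms starting at `j` and moving towards the mean lose at most a factor
  -- `r = 1 - 1 / (2 * L)` per step, hence a factor 2 in all by Bernoulli's inequality. Their sum is
  -- at most 1, so the term at `j` is at most `2 / L < ε`.
  refine ⟨2 * L * (2 * L + 1) + L + 1, by positivity, fun m p h0 hp hM j => ?_⟩
  set q : ℝ := 1 - p with hq
  have hq2 : 1 / 2 ≤ q := by linarith
  have hpq : p ≤ q := by linarith
  have hmq : m * p ≤ m * q := mul_le_mul_of_nonneg_left hpq (Nat.cast_nonneg _)
  have hp0 : 0 < p := by
    rcases h0.eq_or_lt with h | h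
    · rw [← h, mul_zero] at hM; nlinarith
    · exact h
  set t := binomialTerm m p with ht
  have ht0 : ∀ j, 0 ≤ t j := binomialTerm_nonneg h0 (by linarith) m
  rcases lt_or_ge m j with hjm | hjm
  · have : t j = 0 := by simp [ht, binomialTerm, Nat.choose_eq_zero_of_lt hjm]
    rw [this]; exact hε.le
  set r : ℝ := 1 - 1 / (2 * L) with hr
  have hr0 : 0 ≤ r := by
    rw [hr, sub_nonneg, div_le_one (by positivity)]; linarith
  have hrle : r ≤ 1 := by rw [hr]; linarith [show (0 : ℝ) ≤ 1 / (2 * L) by positivity]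
  have hbern : ∀ i ≤ L, 1 / 2 ≤ r ^ i := by
    intro i hi
    have h1 := one_add_mul_le_pow (a := -(1 / (2 * (L : ℝ)))) (by
      have : 1 / (2 * (L : ℝ)) ≤ 1 := by rw [div_le_one (by positivity)]; linarith
      linarith) i
    have h2 : (i : ℝ) * (1 / (2 * L)) ≤ 1 / 2 := by
      have : (i : ℝ) ≤ L := by exact_mod_cast hi
      calc (i : ℝ) * (1 / (2 * L)) ≤ L * (1 / (2 * L)) := by gcongr
        _ = 1 / 2 := by field_simp
    have h3 : r = 1 + -(1 / (2 * (L : ℝ))) := by rw [hr]; ring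
    rw [h3]; linarith
  -- it suffices to find `L` other terms of comparable size
  have finish : ∀ g : ℕ → ℕ, Set.InjOn g (Finset.range L) → (∀ i < L, g i ≤ m) →
      (∀ i < L, r ^ i * t j ≤ t (g i)) → t j ≤ ε := by
    intro g hg hgm hgt
    have h1 : ∑ k ∈ (Finset.range L).image g, t k ≤ 1 :=
      sum_binomialTerm_le_one h0 (by linarith) m _ (by
        intro k hk
        obtain ⟨i, hi, rfl⟩ := Finset.mem_image.1 hk
        exact hgm i (Finset.mem_range.1 hi))
    rw [Finset.sum_image hg] at h1
    have h2 : (L : ℝ) * (1 / 2 * t j) ≤ ∑ i ∈ Finset.range L, t (g i) := by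
      rw [← nsmul_eq_mul, ← Finset.card_range L, ← Finset.sum_const, Finset.card_range]
      refine Finset.sum_le_sum fun i hi => ?_
      have hi := Finset.mem_range.1 hi
      exact (mul_le_mul_of_nonneg_right (hbern i hi.le) (ht0 j)).trans (hgt i hi)
    have h3 : 2 < L * ε := by rwa [div_lt_iff₀ hε] at hL
    by_contra hcon
    push Not at hcon
    nlinarith
  -- This inequality fixes the size of the mean: it bounds the ratio of consecutive terms even `L`
  -- steps beyond the mean.
  have e2 : r * (m * p + L) ≤ m * p - L := by
    have h4 : 1 / (2 * (L : ℝ)) * (2 * L * (2 * L + 1)) = 2 * L + 1 := by field_simp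
    have h5 : 1 / (2 * (L : ℝ)) * (2 * L * (2 * L + 1)) ≤ 1 / (2 * (L : ℝ)) * (m * p + L) := by
      gcongr; linarith
    rw [hr]
    linarith
  rcases le_total (j : ℝ) (m * p) with hj | hj
  · have hup : ∀ i < L, j + i ≤ m ∧ r ^ i * t j ≤ t (j + i) := by
      intro i
      induction i with
      | zero => intro _; simpa using hjm
      | succ i ih =>
        intro hi
        obtain ⟨him, hit⟩ := ih (by omega)
        have hiL : (i : ℝ) + 1 ≤ L := by exact_mod_cast hi.le
        have hi0 : (0 : ℝ) ≤ i := Nat.cast_nonneg _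
        have hlt : j + i < m := by
          have : (j : ℝ) + i < m := by nlinarith
          exact_mod_cast this
        refine ⟨hlt, ?_⟩
        have hrec := binomialTerm_succ_mul m p (j + i) hlt
        push_cast at hrec
        have hD : 0 < ((j : ℝ) + i + 1) * q := by positivity
        have hN : r * (((j : ℝ) + i + 1) * q) ≤ (m - (j + i)) * p := by
          have e1 : r * (((j : ℝ) + i + 1) * q) ≤ r * ((m * p + L) * q) := by
            gcongr r * (?_ * q)
            linarith
          have e3 : (m * p - L) * q ≤ (m - (j + i)) * p := by
            have h6 : (i : ℝ) * p ≤ L * q := by gcongr; linarith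
            have h7 : (j : ℝ) * p ≤ m * p * p := by gcongr
            have h8 : (m : ℝ) * p * q + m * p * p = m * p := by rw [hq]; ring
            linarith
          calc _ ≤ r * ((m * p + L) * q) := e1
            _ = r * (m * p + L) * q := by ring
            _ ≤ (m * p - L) * q := by gcongr
            _ ≤ _ := e3
        have e4 : r * t (j + i) ≤ t (j + i + 1) := by
          have : r * t (j + i) * (((j : ℝ) + i + 1) * q) ≤
              t (j + i + 1) * (((j : ℝ) + i + 1) * q) := by
            rw [hrec]
            nlinarith [mul_le_mul_of_nonneg_left hN (ht0 (j + i))]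
          exact le_of_mul_le_mul_right this hD
        calc r ^ (i + 1) * t j = r * (r ^ i * t j) := by ring
          _ ≤ r * t (j + i) := by gcongr
          _ ≤ _ := e4
    exact finish (fun i => j + i) (fun a _ b _ h => by simpa using h)
      (fun i hi => (hup i hi).1) fun i hi => (hup i hi).2
  · have hdown : ∀ i < L, i ≤ j ∧ r ^ i * t j ≤ t (j - i) := by
      intro i
      induction i with
      | zero => intro _; simp
      | succ i ih =>
        intro hi
        obtain ⟨him, hit⟩ := ih (by omega)
        have hiL : (i : ℝ) + 1 ≤ L := by exact_mod_cast hi.le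
        have hi0 : (0 : ℝ) ≤ i := Nat.cast_nonneg _
        have hlt : i < j := by
          have : (i : ℝ) < j := by nlinarith
          exact_mod_cast this
        refine ⟨hlt, ?_⟩
        obtain ⟨k, hk⟩ : ∃ k, j = k + i + 1 := ⟨j - i - 1, by omega⟩
        have hjk : (j : ℝ) = k + i + 1 := by rw [hk]; push_cast; ring
        have hji : j - i = k + 1 := by omega
        have hji' : j - (i + 1) = k := by omega
        have hkm : k < m := by omega
        have hkm' : (k : ℝ) < m := by exact_mod_cast hkm
        have hrec := binomialTerm_succ_mul m p k hkm
        rw [hji']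
        rw [hji] at hit
        have hD : 0 < ((m : ℝ) - k) * p := by
          have : (0:ℝ) < m - k := by linarith
          positivity
        have hN : r * (((m : ℝ) - k) * p) ≤ (k + 1) * q := by
          have e1 : ((m : ℝ) - k) ≤ m * q + L := by
            have : (m : ℝ) * q = m - m * p := by rw [hq]; ring
            linarith
          have e3 : (m * q + L) * p ≤ (m * p + L) * q := by
            have : (L : ℝ) * p ≤ L * q := by gcongr
            linarith
          calc r * (((m : ℝ) - k) * p) ≤ r * ((m * q + L) * p) := by gcongr
            _ ≤ r * ((m * p + L) * q) := by gcongr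
            _ = r * (m * p + L) * q := by ring
            _ ≤ (m * p - L) * q := by gcongr
            _ ≤ _ := by gcongr; linarith
        have e4 : r * t (k + 1) ≤ t k := by
          have : r * t (k + 1) * (((m : ℝ) - k) * p) ≤ t k * (((m : ℝ) - k) * p) := by
            rw [← hrec]
            nlinarith [mul_le_mul_of_nonneg_left hN (ht0 (k + 1))]
          exact le_of_mul_le_mul_right this hD
        calc r ^ (i + 1) * t j = r * (r ^ i * t j) := by ring
          _ ≤ r * t (k + 1) := by gcongr
          _ ≤ _ := e4
    refine finish (fun i => j - i) ?_ (fun i _ => (Nat.sub_le _ _).trans hjm)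
      fun i hi => (hdown i hi).2
    intro a ha b hb h
    have ha := (hdown a (by simpa using ha)).1
    have hb := (hdown b (by simpa using hb)).1
    simp only at h
    omega

/-- A level set of a linear form with positive coefficients has small product weight. -/
lemma rowWeight_level_le {ι : Type*} [Fintype ι] [DecidableEq ι] {p ε : ℝ} (h0 : 0 ≤ p)
    (h1 : p ≤ 1) (hε : ∀ j, binomialTerm (Fintype.card ι) p j ≤ ε) (z : ι → ℝ)
    (hz : ∀ i, 0 < z i) (a : ℝ) :
    mass (rowWeight ι p) {ω | ∑ i, (if ω i = true then z i else 0) = a} ≤ ε := by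
  classical
  set 𝒜 : Finset (Finset ι) := Finset.univ.filter fun s => ∑ i ∈ s, z i = a with h𝒜
  -- Enlarging an index set strictly increases the sum of positive coefficients, so the level set is
  -- an antichain. The LYM inequality then bounds its weight by the largest binomial term.
  have hanti : IsAntichain (· ⊆ ·) (SetLike.coe 𝒜) := by
    intro s hs t ht hst hsub
    have hs : ∑ i ∈ s, z i = a := by simpa [h𝒜] using hs
    have ht : ∑ i ∈ t, z i = a := by simpa [h𝒜] using ht
    have hss : s ⊂ t := lt_of_le_of_ne hsub hst
    obtain ⟨i, hit, his⟩ := Finset.exists_of_ssubset hss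
    have := Finset.sum_lt_sum_of_subset hsub hit his (hz i) fun j _ _ => (hz j).le
    linarith
  have hLYM := Finset.lubell_yamamoto_meshalkin_inequality_sum_inv_choose (𝕜 := ℝ) hanti
  have hε0 : 0 ≤ ε := (binomialTerm_nonneg h0 h1 _ 0).trans (hε 0)
  have hw : ∀ s : Finset ι, rowWeight ι p (fun i => decide (i ∈ s)) =
      p ^ s.card * (1 - p) ^ (Fintype.card ι - s.card) := by
    intro s
    simp only [rowWeight, prodWeight, bernoulliWeight, decide_eq_true_eq]
    rw [Finset.prod_ite]
    simp [Finset.filter_not, Finset.card_sdiff]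
  have hsum : mass (rowWeight ι p) {ω | ∑ i, (if ω i = true then z i else 0) = a} =
      ∑ s ∈ 𝒜, p ^ s.card * (1 - p) ^ (Fintype.card ι - s.card) := by
    unfold mass
    simp_rw [Set.indicator_apply]
    rw [← Finset.sum_filter]
    refine Finset.sum_nbij' (fun ω => Finset.univ.filter fun i => ω i = true)
      (fun s i => decide (i ∈ s)) ?_ ?_ ?_ ?_ ?_
    · intro ω hω
      simpa [h𝒜, Finset.sum_filter] using hω
    · intro s hs
      simpa [h𝒜] using hs
    · intro ω _; ext i; simp
    · intro s _; ext i; simp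
    · intro ω _
      rw [← hw]
      congr 1
      ext i; simp
  rw [hsum]
  calc _ ≤ ∑ s ∈ 𝒜, ε * ((Fintype.card ι).choose s.card : ℝ)⁻¹ := by
        refine Finset.sum_le_sum fun s _ => ?_
        have hc : (0 : ℝ) < (Fintype.card ι).choose s.card := by
          exact_mod_cast Nat.choose_pos (Finset.card_le_univ s)
        rw [← div_eq_mul_inv, le_div_iff₀ hc]
        calc _ = binomialTerm (Fintype.card ι) p s.card := by unfold binomialTerm; ring
          _ ≤ ε := hε _
    _ = ε * ∑ s ∈ 𝒜, ((Fintype.card ι).choose s.card : ℝ)⁻¹ := by rw [Finset.mul_sum]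
    _ ≤ ε * 1 := by gcongr
    _ = ε := mul_one _

lemma rowWeight_nonneg {κ : Type*} [Fintype κ] {p : ℝ} (h0 : 0 ≤ p) (h1 : p ≤ 1) (ω : κ → Bool) :
    0 ≤ rowWeight κ p ω := prodWeight_nonneg (bernoulliWeight_nonneg h0 h1) ω

lemma sum_rowWeight (κ : Type*) [Fintype κ] [DecidableEq κ] (p : ℝ) :
    ∑ ω, rowWeight κ p ω = 1 := sum_prodWeight_eq_one (sum_bernoulliWeight p)

/-- The product of a zero-one row with a real vector. -/
def rowDot {κ : Type*} [Fintype κ] (ω : κ → Bool) (z : κ → ℝ) : ℝ :=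
  ∑ j, if ω j = true then z j else 0

lemma rowDot_neg {κ : Type*} [Fintype κ] (ω : κ → Bool) (z : κ → ℝ) :
    rowDot ω (-z) = -rowDot ω z := by
  unfold rowDot
  rw [← Finset.sum_neg_distrib]
  exact Finset.sum_congr rfl fun j _ => by split_ifs <;> simp

lemma mass_rowDot_le_of_pos {κ : Type*} [Fintype κ] [DecidableEq κ] {p ε : ℝ} (h0 : 0 ≤ p)
    (h1 : p ≤ 1) (z : κ → ℝ)
    (hε : ∀ j, binomialTerm (Fintype.card {i // 0 < z i}) p j ≤ ε) :
    mass (rowWeight κ p) {ω | rowDot ω z = 0} ≤ ε := by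
  refine mass_le_of_split (bernoulliWeight_nonneg h0 h1) (sum_bernoulliWeight p)
    (fun i => 0 < z i) _ fun g => ?_
  refine le_trans (le_of_eq ?_) (rowWeight_level_le h0 h1 hε (fun i => z i.1) (fun i => i.2)
    (-∑ i, if g i = true then z i.1 else 0))
  congr 1
  ext f
  simp only [Set.mem_ofPred_eq, rowDot]
  rw [← Fintype.sum_subtype_add_sum_subtype (fun i => 0 < z i), ← eq_neg_iff_add_eq_zero]
  have e1 : ∀ i : {i // 0 < z i}, (if hi : 0 < z i then f ⟨i, hi⟩ else g ⟨i, hi⟩) = f i :=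
    fun i => by simp [i.2]
  have e2 : ∀ i : {i // ¬ 0 < z i}, (if hi : 0 < z i then f ⟨i, hi⟩ else g ⟨i, hi⟩) = g i :=
    fun i => by rw [dif_neg i.2]
  simp_rw [e1, e2]

/-- A sparse Littlewood–Offord bound without rate. -/
lemma mass_rowDot_le {ε : ℝ} (hε : 0 < ε) : ∃ M : ℝ, 0 < M ∧ ∀ (κ : Type) [Fintype κ]
    [DecidableEq κ] (p : ℝ), 0 ≤ p → p ≤ 1 / 2 → ∀ (z : κ → ℝ) (s : Finset κ),
    (∀ j ∈ s, z j ≠ 0) → M ≤ s.card * p → mass (rowWeight κ p) {ω | rowDot ω z = 0} ≤ ε := by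
  obtain ⟨M, hM0, hM⟩ := binomialTerm_le hε
  -- The factor 2 pays for keeping only the majority sign among the nonzero coordinates; `z` may be
  -- replaced by `-z`.
  refine ⟨2 * M, by positivity, fun κ _ _ p h0 hp z s hz hs => ?_⟩
  have hcard : s.card ≤ Fintype.card {i // 0 < z i} + Fintype.card {i // 0 < (-z) i} := by
    rw [Fintype.card_subtype, Fintype.card_subtype]
    refine le_trans (Finset.card_le_card fun j hj => ?_) (Finset.card_union_le _ _)
    rcases (hz j hj).lt_or_gt with h | h <;> simp [h]
  have hcard' : (s.card : ℝ) ≤ Fintype.card {i // 0 < z i} + Fintype.card {i // 0 < (-z) i} := by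
    exact_mod_cast hcard
  rcases le_or_gt M (Fintype.card {i // 0 < z i} * p) with h | h
  · exact mass_rowDot_le_of_pos h0 (by linarith) z (hM _ p h0 hp h)
  · have h' : M ≤ Fintype.card {i // 0 < (-z) i} * p := by nlinarith
    simpa [rowDot_neg] using mass_rowDot_le_of_pos h0 (by linarith) (-z) (hM _ p h0 hp h')

/-! ### Linear algebra of minimal dependencies. -/

section Dependency

variable {ι κ : Type*} [Fintype κ] {k : ℕ} {M : Matrix ι κ ℝ}

lemma IsMinimalDependency.eq_smul (h : IsMinimalDependency k M) {x : κ → ℝ}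
    (hx : M.mulVec x = 0) (hx0 : x ≠ 0) {y : κ → ℝ} (hy : M.mulVec y = 0) :
    ∃ c : ℝ, y = c • x := by
  obtain ⟨hk, -, hr⟩ := h
  have hker : Module.finrank ℝ (LinearMap.ker M.mulVecLin) = 1 := by
    have := LinearMap.finrank_range_add_finrank_ker M.mulVecLin
    rw [Module.finrank_fintype_fun_eq_card, hk] at this
    have hr' : Module.finrank ℝ (LinearMap.range M.mulVecLin) + 1 = k := hr
    omega
  have hx' : x ∈ LinearMap.ker M.mulVecLin := by simpa using hx
  have hy' : y ∈ LinearMap.ker M.mulVecLin := by simpa using hy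
  obtain ⟨c, hc⟩ := (finrank_eq_one_iff_of_nonzero' (⟨x, hx'⟩ : LinearMap.ker M.mulVecLin)
    (by simpa [Subtype.ext_iff] using hx0)).1 hker ⟨y, hy'⟩
  exact ⟨c, (congrArg Subtype.val hc).symm⟩

lemma exists_rows_mulVec_eq_zero [Fintype ι] (M : Matrix ι κ ℝ) :
    ∃ R : Finset ι, R.card = M.rank ∧
      ∀ x : κ → ℝ, (∀ i ∈ R, M.mulVec x i = 0) → M.mulVec x = 0 := by
  classical
  obtain ⟨τ, a, ha, hspan, hli⟩ := exists_linearIndependent' ℝ M.row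
  have : Fintype τ := Fintype.ofInjective a ha
  refine ⟨Finset.univ.image a, ?_, fun x hx => ?_⟩
  · rw [Finset.card_image_of_injective _ ha, Finset.card_univ, ← finrank_span_eq_card hli, hspan,
      ← Matrix.rank_eq_finrank_span_row]
  · ext i
    have hi : M.row i ∈ Submodule.span ℝ (Set.range (M.row ∘ a)) := by
      rw [hspan]; exact Submodule.subset_span ⟨i, rfl⟩
    have : ∀ v ∈ Submodule.span ℝ (Set.range (M.row ∘ a)), v ⬝ᵥ x = 0 := by
      intro v hv
      induction hv using Submodule.span_induction with
      | mem v hv =>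
        obtain ⟨t, rfl⟩ := hv
        exact hx (a t) (Finset.mem_image_of_mem a (Finset.mem_univ t))
      | zero => simp
      | add u v _ _ hu hv => rw [add_dotProduct, hu, hv, add_zero]
      | smul c v _ hv => rw [smul_dotProduct, hv, smul_zero]
    exact this _ hi

lemma rank_le_card_nonzero_rows [Fintype ι] [DecidableEq ι] (M : Matrix ι κ ℝ) (R : Finset ι)
    (hR : ∀ i ∉ R, M i = 0) : M.rank ≤ R.card := by
  classical
  rw [Matrix.rank_eq_finrank_span_row]
  have hle : Submodule.span ℝ (Set.range M.row) ≤
      Submodule.span ℝ ((R.image M.row : Finset (κ → ℝ)) : Set (κ → ℝ)) := by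
    rw [Submodule.span_le]
    rintro _ ⟨i, rfl⟩
    by_cases hi : i ∈ R
    · exact Submodule.subset_span (Finset.mem_coe.2 (Finset.mem_image_of_mem _ hi))
    · have : M.row i = 0 := hR i hi
      rw [this]; exact Submodule.zero_mem _
  calc _ ≤ Module.finrank ℝ (Submodule.span ℝ ((R.image M.row : Finset (κ → ℝ)) : Set (κ → ℝ))) :=
        Submodule.finrank_mono hle
    _ ≤ (R.image M.row).card := finrank_span_finset_le_card _
    _ ≤ R.card := Finset.card_image_le

/-- The graph on the columns in which two columns are adjacent if some row has a one in both. -/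
def columnGraph (M : Matrix ι κ ℝ) : SimpleGraph κ where
  Adj u v := u ≠ v ∧ ∃ i, M i u = 1 ∧ M i v = 1
  symm := ⟨fun _ _ ⟨h, i, h1, h2⟩ => ⟨h.symm, i, h2, h1⟩⟩
  loopless := ⟨fun _ h => h.1 rfl⟩

/-- The ones of a row all lie in one component, so restricting a kernel vector to a component keeps
it in the kernel. The kernel is a line, so a full-support vector cannot have a proper restriction
there. -/
lemma IsMinimalDependency.columnGraph_connected (h : IsMinimalDependency k M)
    (h01 : ∀ i j, M i j = 0 ∨ M i j = 1) : (columnGraph M).Connected := by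
  classical
  obtain ⟨x, hx, hx0⟩ := h.2.1
  have hne : Nonempty κ := by
    rw [← Fintype.card_pos_iff, h.1, ← h.2.2]; omega
  refine ⟨fun u v => ?_⟩
  by_contra huv
  set y : κ → ℝ := fun j => if (columnGraph M).Reachable u j then x j else 0 with hy
  have hyker : M.mulVec y = 0 := by
    ext i
    have hxi : ∑ j, M i j * x j = 0 := congrFun hx i
    change ∑ j, M i j * y j = 0
    by_cases hi : ∃ w, M i w = 1 ∧ (columnGraph M).Reachable u w
    · obtain ⟨w, hw, huw⟩ := hi
      rw [← hxi]
      refine Finset.sum_congr rfl fun j _ => ?_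
      rcases h01 i j with hj | hj
      · simp [hj]
      · have : (columnGraph M).Reachable u j := by
          by_cases hwj : w = j
          · exact hwj ▸ huw
          · exact huw.trans (SimpleGraph.Adj.reachable ⟨hwj, i, hw, hj⟩)
        simp [hy, this]
    · push Not at hi
      refine Finset.sum_eq_zero fun j _ => ?_
      rcases h01 i j with hj | hj
      · simp [hj]
      · simp [hy, hi j hj]
  obtain ⟨c, hc⟩ := h.eq_smul hx (fun h0 => hx0 u (congrFun h0 u)) hyker
  have hu : x u = c * x u := by simpa [hy] using congrFun hc u
  have hv : 0 = c * x v := by simpa [hy, huv] using congrFun hc v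
  rcases mul_eq_zero.1 hv.symm with h0 | h0
  · rw [h0, zero_mul] at hu; exact hx0 u hu
  · exact hx0 v h0

open Classical in
/-- A minimal dependency with exactly `k - 1` nonzero rows, each of them having exactly two ones,
is a tree dependency. -/
lemma IsMinimalDependency.isTreeDependency [Fintype ι] (h : IsMinimalDependency k M)
    (h01 : ∀ i j, M i j = 0 ∨ M i j = 1)
    (h2 : ∀ i, M i ≠ 0 → (Finset.univ.filter fun j => M i j = 1).card = 2)
    (hcard : (Finset.univ.filter fun i => M i ≠ 0).card + 1 = k) : IsTreeDependency k M := by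
  have hconn := h.columnGraph_connected h01
  refine ⟨h.1, h01, ?_, columnGraph M, ?_⟩
  · have e : {q : ι × κ | M q.1 q.2 = 1} =
        ((Finset.univ.filter fun q : ι × κ => M q.1 q.2 = 1 : Finset (ι × κ)) : Set (ι × κ)) := by
      ext q; simp
    have hones : (Finset.univ.filter fun q : ι × κ => M q.1 q.2 = 1).card =
        2 * (Finset.univ.filter fun i => M i ≠ 0).card := by
      rw [Finset.card_filter, Fintype.sum_prod_type]
      simp_rw [← Finset.card_filter]
      rw [mul_comm, ← smul_eq_mul, ← Finset.sum_const, Finset.sum_filter]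
      refine Finset.sum_congr rfl fun i _ => ?_
      split_ifs with hi
      · exact h2 i hi
      · push Not at hi
        simp [hi]
    rw [e, Set.encard_coe_eq_coe_finsetCard, hones, ← hcard]
    push_cast
    ring
  · have hedge : ∀ i : {i : ι // M i ≠ 0}, ∃ e : (columnGraph M).edgeSet,
        ∀ j, M i j = 1 ↔ j ∈ (e : Sym2 κ) := by
      intro i
      obtain ⟨u, v, huv, he⟩ := Finset.card_eq_two.1 (h2 i.1 i.2)
      have hm : ∀ j, M i j = 1 ↔ j = u ∨ j = v := by
        intro j
        have := Finset.ext_iff.1 he j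
        simpa using this
      exact ⟨⟨s(u, v), huv, i, (hm u).2 (.inl rfl), (hm v).2 (.inr rfl)⟩, fun j => by
        rw [hm, Sym2.mem_iff]⟩
    choose g hg using hedge
    have hsurj : Function.Surjective g := by
      rintro ⟨e, he⟩
      induction e using Sym2.ind with
      | _ u v =>
        obtain ⟨huv, i, hiu, hiv⟩ := he
        have hi : M i ≠ 0 := fun h0 => by
          have := congrFun h0 u
          rw [hiu] at this
          exact one_ne_zero this
        refine ⟨⟨i, hi⟩, Subtype.ext ?_⟩
        exact (Sym2.mem_and_mem_iff huv).1 ⟨(hg ⟨i, hi⟩ u).1 hiu, (hg ⟨i, hi⟩ v).1 hiv⟩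
    have hc1 : Nat.card {i : ι // M i ≠ 0} + 1 = Nat.card κ := by
      rw [Nat.card_eq_fintype_card, Nat.card_eq_fintype_card, Fintype.card_subtype, h.1, hcard]
    -- The `k - 1` nonzero rows surject onto the edges of a connected graph on `k` vertices, which
    -- has at least `k - 1` edges. Equality makes the graph a tree and the surjection a bijection.
    have hc2 := hconn.card_vert_le_card_edgeSet_add_one
    have hc3 : Nat.card (columnGraph M).edgeSet ≤ Nat.card {i : ι // M i ≠ 0} :=
      Nat.card_le_card_of_surjective g hsurj
    have hbij : Function.Bijective g :=
      (Nat.bijective_iff_surjective_and_card g).2 ⟨hsurj, by omega⟩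
    refine ⟨?_, Equiv.ofBijective g hbij, fun i j => hg i j⟩
    rw [SimpleGraph.isTree_iff_connected_and_card]
    exact ⟨hconn, by omega⟩

end Dependency

/-! ### Dependencies of zero-one matrices in terms of row counts. -/

section ZeroOne

variable {n : ℕ}

/-- The zero-one matrix with given rows. -/
abbrev ofRows (f : Fin n → Fin n → Bool) : Matrix (Fin n) (Fin n) ℝ :=
  zeroOneMatrix fun q => f q.1 q.2

/-- The number of ones of a row in the columns of `S`. -/
def onesIn {κ : Type*} (ω : κ → Bool) (S : Finset κ) : ℕ := (S.filter fun j => ω j = true).card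

lemma columns_mulVec (f : Fin n → Fin n → Bool) (S : Finset (Fin n)) (z : Fin n → ℝ)
    (hz : ∀ j ∉ S, z j = 0) (i : Fin n) :
    (columns (ofRows f) S).mulVec (fun j => z j) i = rowDot (f i) z := by
  simp only [Matrix.mulVec, dotProduct, columns, zeroOneMatrix, rowDot, Matrix.submatrix_apply,
    Matrix.of_apply, id, ite_mul, one_mul, zero_mul]
  rw [Finset.sum_coe_sort S (fun j => if f i j = true then z j else 0)]
  refine Finset.sum_subset (Finset.subset_univ S) fun j _ hj => ?_
  simp [hz j hj]

lemma onesIn_eq_card (f : Fin n → Fin n → Bool) (S : Finset (Fin n)) (i : Fin n) :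
    (Finset.univ.filter fun j => columns (ofRows f) S i j = 1).card = onesIn (f i) S := by
  unfold onesIn
  rw [← Finset.card_map (Function.Embedding.subtype (· ∈ S))]
  congr 1
  ext j
  simp [columns, zeroOneMatrix, and_comm]

lemma columns_eq_zero_iff (f : Fin n → Fin n → Bool) (S : Finset (Fin n)) (i : Fin n) :
    columns (ofRows f) S i = 0 ↔ onesIn (f i) S = 0 := by
  simp [funext_iff, columns, zeroOneMatrix, onesIn, Finset.filter_eq_empty_iff]

variable {f : Fin n → Fin n → Bool} {S : Finset (Fin n)} {k : ℕ}

lemma IsMinimalDependency.exists_kernel (h : IsMinimalDependency k (columns (ofRows f) S)) :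
    ∃ z : Fin n → ℝ, (∀ j ∈ S, z j ≠ 0) ∧ (∀ j ∉ S, z j = 0) ∧ ∀ i, rowDot (f i) z = 0 := by
  obtain ⟨x, hx, hx0⟩ := h.2.1
  set z : Fin n → ℝ := fun j => if hj : j ∈ S then x ⟨j, hj⟩ else 0 with hz
  have hzS : ∀ j ∉ S, z j = 0 := fun j hj => by simp [hz, hj]
  refine ⟨z, fun j hj => by simpa [hz, hj] using hx0 ⟨j, hj⟩, hzS, fun i => ?_⟩
  rw [← columns_mulVec f S z hzS i]
  have : (fun j : S => z j) = x := by ext j; simp [hz]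
  rw [this, hx]; rfl

lemma IsMinimalDependency.exists_rows (h : IsMinimalDependency k (columns (ofRows f) S)) :
    ∃ R : Finset (Fin n), R.card + 1 = k ∧ ∀ z : Fin n → ℝ, (∀ j ∉ S, z j = 0) →
      (∀ i ∈ R, rowDot (f i) z = 0) → ∀ i, rowDot (f i) z = 0 := by
  obtain ⟨R, hR, hker⟩ := exists_rows_mulVec_eq_zero (columns (ofRows f) S)
  refine ⟨R, by rw [hR]; exact h.2.2, fun z hz hzR i => ?_⟩
  rw [← columns_mulVec f S z hz i, hker _ fun i hi => by rw [columns_mulVec f S z hz, hzR i hi]]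
  rfl

lemma IsMinimalDependency.onesIn_ne_one (h : IsMinimalDependency k (columns (ofRows f) S))
    (i : Fin n) : onesIn (f i) S ≠ 1 := by
  intro h1
  obtain ⟨z, hz, hz0, hker⟩ := h.exists_kernel
  obtain ⟨j, hj⟩ := Finset.card_eq_one.1 h1
  have hmem : ∀ l, (l ∈ S ∧ f i l = true) ↔ l = j := fun l => by
    have := Finset.ext_iff.1 hj l
    simpa using this
  have hi := hker i
  rw [rowDot, Finset.sum_eq_single j] at hi
  · rw [if_pos ((hmem j).2 rfl).2] at hi
    exact hz j ((hmem j).2 rfl).1 hi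
  · intro l _ hl
    split_ifs with hfl
    · exact hz0 l fun hlS => hl ((hmem l).1 ⟨hlS, hfl⟩)
    · rfl
  · simp

/-- A minimal dependency which is not a tree dependency has an excess of ones. -/
lemma IsMinimalDependency.excess (h : IsMinimalDependency k (columns (ofRows f) S))
    (ht : ¬ IsTreeDependency k (columns (ofRows f) S)) :
    (∃ R : Finset (Fin n), R.card = k ∧ ∀ i ∈ R, 2 ≤ onesIn (f i) S) ∨
    ∃ R : Finset (Fin n), R.card + 1 = k ∧ (∀ i ∈ R, 2 ≤ onesIn (f i) S) ∧
      ∃ i ∈ R, 3 ≤ onesIn (f i) S := by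
  classical
  set R : Finset (Fin n) := Finset.univ.filter fun i => columns (ofRows f) S i ≠ 0 with hRdef
  have hR2 : ∀ i ∈ R, 2 ≤ onesIn (f i) S := by
    intro i hi
    have h0 : onesIn (f i) S ≠ 0 := by
      rw [hRdef, Finset.mem_filter, Ne, columns_eq_zero_iff] at hi
      exact hi.2
    have := h.onesIn_ne_one i
    omega
  have hRk : k ≤ R.card + 1 := by
    have := rank_le_card_nonzero_rows (columns (ofRows f) S) R (fun i hi => by
      by_contra h0
      exact hi (by simp [hRdef, h0]))
    have hr := h.2.2
    omega
  -- The rank forces at least `k - 1` nonzero rows. If there are exactly `k - 1` and all have two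
  -- ones, the dependency is a tree.
  rcases hRk.lt_or_eq with hlt | heq
  · obtain ⟨R', hR', hc⟩ := Finset.exists_subset_card_eq (Nat.lt_succ_iff.1 hlt)
    exact .inl ⟨R', hc, fun i hi => hR2 i (hR' hi)⟩
  · refine .inr ⟨R, heq.symm, hR2, ?_⟩
    by_contra hcon
    push Not at hcon
    refine ht (h.isTreeDependency (fun i j => ?_) (fun i hi => ?_) heq.symm)
    · by_cases hb : f i j = true <;> simp [columns, zeroOneMatrix, hb]
    · have hiR : i ∈ R := by simp [hRdef, hi]
      rw [onesIn_eq_card]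
      exact le_antisymm (Nat.lt_succ_iff.1 (hcon i hiR)) (hR2 i hiR)

end ZeroOne

/-! ### Probabilities for the number of ones of a single row. -/

section Row

variable {κ : Type*} [Fintype κ] [DecidableEq κ] {p : ℝ}

lemma mass_bernoulliWeight_true (p : ℝ) : mass (bernoulliWeight p) {b | b = true} = p := by
  simp [mass, bernoulliWeight]

lemma mass_bernoulliWeight_false (p : ℝ) : mass (bernoulliWeight p) {b | b = false} = 1 - p := by
  simp [mass, bernoulliWeight]

lemma mass_forall_true (p : ℝ) (T : Finset κ) :
    mass (rowWeight κ p) {ω | ∀ j ∈ T, ω j = true} = p ^ T.card := by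
  have e : {ω : κ → Bool | ∀ j ∈ T, ω j = true} =
      {ω | ∀ j, ω j ∈ if j ∈ T then {b | b = true} else Set.univ} := by
    ext ω
    refine forall_congr' fun j => ?_
    split_ifs with h <;> simp [h]
  rw [e, mass_pi]
  calc _ = ∏ j, if j ∈ T then p else 1 := Finset.prod_congr rfl fun j _ => by
        split_ifs
        · exact mass_bernoulliWeight_true p
        · rw [mass_univ, sum_bernoulliWeight]
    _ = _ := by simp

lemma mass_le_onesIn (h0 : 0 ≤ p) (h1 : p ≤ 1) (S : Finset κ) (r : ℕ) :
    mass (rowWeight κ p) {ω | r ≤ onesIn ω S} ≤ (S.card * p) ^ r := by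
  calc _ ≤ ∑ T ∈ S.powersetCard r, mass (rowWeight κ p) {ω | ∀ j ∈ T, ω j = true} := by
        refine mass_le_sum (rowWeight_nonneg h0 h1) _ _ fun ω hω => ?_
        obtain ⟨T, hT, hc⟩ := Finset.exists_subset_card_eq hω
        refine ⟨T, Finset.mem_powersetCard.2 ⟨fun j hj => (Finset.mem_filter.1 (hT hj)).1, hc⟩,
          fun j hj => (Finset.mem_filter.1 (hT hj)).2⟩
    _ = ∑ T ∈ S.powersetCard r, p ^ r := Finset.sum_congr rfl fun T hT => by
        rw [mass_forall_true, (Finset.mem_powersetCard.1 hT).2]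
    _ = S.card.choose r * p ^ r := by simp
    _ ≤ (S.card : ℝ) ^ r * p ^ r := by
        gcongr
        exact_mod_cast Nat.choose_le_pow S.card r
    _ = _ := by rw [mul_pow]

lemma le_mass_onesIn_eq_one (h0 : 0 ≤ p) (h1 : p ≤ 1) (S : Finset κ) :
    S.card * p * (1 - p) ^ S.card ≤ mass (rowWeight κ p) {ω | onesIn ω S = 1} := by
  set B : κ → Set (κ → Bool) := fun j =>
    {ω | ∀ l, ω l ∈ if l = j then {b | b = true} else if l ∈ S then {b | b = false} else Set.univ}
    with hB
  have hq : 0 ≤ 1 - p := by linarith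
  have hBj : ∀ j ∈ S, p * (1 - p) ^ S.card ≤ mass (rowWeight κ p) (B j) := by
    intro j hj
    rw [hB, mass_pi, ← Finset.mul_prod_erase _ _ (Finset.mem_univ j)]
    have e : ∏ l ∈ Finset.univ.erase j, mass (bernoulliWeight p)
        (if l = j then {b | b = true} else if l ∈ S then {b | b = false} else Set.univ) =
        ∏ l ∈ Finset.univ.erase j, if l ∈ S then 1 - p else 1 := by
      refine Finset.prod_congr rfl fun l hl => ?_
      rw [if_neg (Finset.ne_of_mem_erase hl)]
      split_ifs
      · exact mass_bernoulliWeight_false p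
      · rw [mass_univ, sum_bernoulliWeight]
    rw [e, if_pos rfl, mass_bernoulliWeight_true]
    gcongr
    rw [Finset.prod_ite, Finset.prod_const_one, mul_one, Finset.prod_const]
    refine pow_le_pow_of_le_one hq (by linarith) (Finset.card_le_card fun l hl => ?_)
    exact (Finset.mem_filter.1 hl).2
  have hmem : ∀ j ∈ S, ∀ ω ∈ B j, ω j = true ∧ ∀ l ∈ S, ω l = true → l = j := by
    intro j _ ω hω
    refine ⟨by simpa using hω j, fun l hl hlt => ?_⟩
    by_contra hlj
    have := hω l
    simp [hlj, hl, hlt] at this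
  calc _ = ∑ j ∈ S, p * (1 - p) ^ S.card := by simp [mul_assoc]
    _ ≤ ∑ j ∈ S, mass (rowWeight κ p) (B j) := Finset.sum_le_sum hBj
    _ ≤ _ := by
      refine sum_mass_le (rowWeight_nonneg h0 h1) S B (fun j hj ω hω => ?_) ?_
      · obtain ⟨ht, hu⟩ := hmem j hj ω hω
        refine Finset.card_eq_one.2 ⟨j, ?_⟩
        ext l
        rw [Finset.mem_filter, Finset.mem_singleton]
        exact ⟨fun h => hu l h.1 h.2, fun h => h ▸ ⟨hj, ht⟩⟩
      · intro ω i hi j hj hωi hωj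
        exact (hmem j hj ω hωj).2 i hi (hmem i hi ω hωi).1

lemma mass_onesIn_ne_one_le (h0 : 0 ≤ p) (h1 : p ≤ 1) (S : Finset κ) :
    mass (rowWeight κ p) {ω | onesIn ω S ≠ 1} ≤ 1 - S.card * p * (1 - p) ^ S.card := by
  have h := mass_add_compl (W := rowWeight κ p) {ω : κ → Bool | onesIn ω S = 1}
  rw [sum_rowWeight] at h
  have := le_mass_onesIn_eq_one h0 h1 S
  have e : {ω : κ → Bool | onesIn ω S ≠ 1} = {ω | onesIn ω S = 1}ᶜ := rfl
  rw [e]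
  linarith

lemma mass_onesIn_ne_one_le_exp (h0 : 0 ≤ p) (h1 : p ≤ 1) (S : Finset κ)
    (hS : S.card * p ≤ 1 / 2) :
    mass (rowWeight κ p) {ω | onesIn ω S ≠ 1} ≤ Real.exp (-(S.card * p / 2)) := by
  have hb : 1 / 2 ≤ (1 - p) ^ S.card := by
    have := one_add_mul_le_pow (a := -p) (by linarith) S.card
    rw [← sub_eq_add_neg] at this
    linarith
  have hk : 0 ≤ S.card * p := by positivity
  have := Real.add_one_le_exp (-(S.card * p / 2))
  have h2 := mass_onesIn_ne_one_le h0 h1 S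
  nlinarith

lemma mass_onesIn_ne_one_le_const (h0 : 0 ≤ p) (h1 : p ≤ 1 / 2) {M : ℝ} (S : Finset κ)
    (hS : 1 / 2 ≤ S.card * p) (hM : S.card * p ≤ M) :
    mass (rowWeight κ p) {ω | onesIn ω S ≠ 1} ≤ 1 - Real.exp (-(2 * M)) / 2 := by
  have hb : Real.exp (-(2 * M)) ≤ (1 - p) ^ S.card := by
    have h3 : Real.exp (-(2 * p)) ≤ 1 - p := by
      rw [Real.exp_neg, inv_le_comm₀ (Real.exp_pos _) (by linarith)]
      refine le_trans ?_ (Real.add_one_le_exp _)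
      rw [inv_le_iff_one_le_mul₀ (by linarith)]
      nlinarith
    calc Real.exp (-(2 * M)) ≤ Real.exp (S.card * -(2 * p)) := Real.exp_le_exp.2 (by nlinarith)
      _ = Real.exp (-(2 * p)) ^ S.card := Real.exp_nat_mul _ _
      _ ≤ _ := by gcongr
  have h2 := mass_onesIn_ne_one_le h0 (by linarith) S
  have := Real.exp_pos (-(2 * M))
  nlinarith

end Row

/-! ### First-moment bounds for small and moderate column sets. -/

section Small

variable {n : ℕ} {p : ℝ}

/-- Some set of `k` columns has no row with a single one, but an excess of ones. -/
def excessEvent (n k : ℕ) : Set (Fin n → Fin n → Bool) :=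
  {f | ∃ S : Finset (Fin n), S.card = k ∧ (∀ i, onesIn (f i) S ≠ 1) ∧
    ((∃ R : Finset (Fin n), R.card = k ∧ ∀ i ∈ R, 2 ≤ onesIn (f i) S) ∨
      ∃ R : Finset (Fin n), R.card + 1 = k ∧ (∀ i ∈ R, 2 ≤ onesIn (f i) S) ∧
        ∃ i ∈ R, 3 ≤ onesIn (f i) S)}

/-- Since `k * p ≤ 1/2 ≤ n * p / 2`, at least half of the rows lie outside `R`, which turns `k * p /
2` per row into `k * (n * p) / 4`. -/
lemma prod_rows_le (h0 : 0 ≤ p) (hd : 1 ≤ n * p) {k : ℕ} (hk : k * p ≤ 1 / 2)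
    (R : Finset (Fin n)) (hR : R.card ≤ k) :
    ∏ i, (if i ∈ R then ((k : ℝ) * p) ^ 2 else Real.exp (-(k * p / 2))) ≤
      (k * p) ^ (2 * R.card) * Real.exp (-(k * (n * p) / 4)) := by
  rw [Finset.prod_ite, Finset.prod_const, Finset.prod_const, ← pow_mul]
  have e1 : (Finset.univ.filter fun i => i ∈ R) = R := by ext; simp
  have e2 : (Finset.univ.filter fun i => i ∉ R).card = n - R.card := by
    rw [Finset.filter_not, e1, Finset.card_sdiff_of_subset (Finset.subset_univ R)]; simp
  rw [e1, e2]
  gcongr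
  rw [← Real.exp_nat_mul]
  refine Real.exp_le_exp.2 ?_
  have hRk : (R.card : ℝ) ≤ k := by exact_mod_cast hR
  have hp : 0 < p := by
    rcases h0.eq_or_lt with h | h
    · rw [← h] at hd; linarith
    · exact h
  have h2k : (k : ℝ) ≤ n / 2 := by
    by_contra hcon
    push Not at hcon
    nlinarith
  have hRn : R.card ≤ n := by simpa using Finset.card_le_univ R
  rw [Nat.cast_sub hRn]
  have : (n : ℝ) / 2 ≤ n - R.card := by linarith
  have hkp : 0 ≤ k * p := by positivity
  nlinarith

lemma mass_rows_le (h0 : 0 ≤ p) (h1 : p ≤ 1) (hd : 1 ≤ n * p) (S R : Finset (Fin n))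
    (hS : S.card * p ≤ 1 / 2) (hR : R.card ≤ S.card) :
    mass (matrixWeight (Fin n) (Fin n) p)
        {f | (∀ i, onesIn (f i) S ≠ 1) ∧ ∀ i ∈ R, 2 ≤ onesIn (f i) S} ≤
      (S.card * p) ^ (2 * R.card) * Real.exp (-(S.card * (n * p) / 4)) := by
  refine le_trans ?_ (prod_rows_le h0 hd hS R hR)
  calc _ ≤ mass (matrixWeight (Fin n) (Fin n) p)
        {f | ∀ i, f i ∈ if i ∈ R then {ω | 2 ≤ onesIn ω S} else {ω | onesIn ω S ≠ 1}} := by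
        refine mass_mono (prodWeight_nonneg (rowWeight_nonneg h0 h1)) fun f hf i => ?_
        split_ifs with hi
        · exact hf.2 i hi
        · exact hf.1 i
    _ = _ := mass_pi _
    _ ≤ _ := Finset.prod_le_prod (fun i _ => mass_nonneg (rowWeight_nonneg h0 h1) _)
        fun i _ => by
          split_ifs
          · exact mass_le_onesIn h0 h1 S 2
          · exact mass_onesIn_ne_one_le_exp h0 h1 S hS

lemma mass_rows_le' (h0 : 0 ≤ p) (h1 : p ≤ 1) (hd : 1 ≤ n * p) (S R : Finset (Fin n))
    (hS : S.card * p ≤ 1 / 2) (hR : R.card ≤ S.card) (i₀ : Fin n) (hi₀ : i₀ ∈ R) :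
    mass (matrixWeight (Fin n) (Fin n) p)
        {f | (∀ i, onesIn (f i) S ≠ 1) ∧ (∀ i ∈ R, 2 ≤ onesIn (f i) S) ∧ 3 ≤ onesIn (f i₀) S} ≤
      (S.card * p) ^ (2 * R.card + 1) * Real.exp (-(S.card * (n * p) / 4)) := by
  have hkp : 0 ≤ S.card * p := by positivity
  calc _ ≤ mass (matrixWeight (Fin n) (Fin n) p)
        {f | ∀ i, f i ∈ if i ∈ R then {ω | (if i = i₀ then 3 else 2) ≤ onesIn ω S}
          else {ω | onesIn ω S ≠ 1}} := by
        refine mass_mono (prodWeight_nonneg (rowWeight_nonneg h0 h1)) fun f hf i => ?_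
        split_ifs with hi hi0
        · subst hi0; exact hf.2.2
        · exact hf.2.1 i hi
        · exact hf.1 i
    _ = _ := mass_pi _
    _ ≤ ∏ i, ((if i ∈ R then ((S.card : ℝ) * p) ^ 2 else Real.exp (-(S.card * p / 2))) *
          (if i = i₀ then (S.card : ℝ) * p else 1)) :=
        Finset.prod_le_prod (fun i _ => mass_nonneg (rowWeight_nonneg h0 h1) _)
        fun i _ => by
          split_ifs with hi hi0 hi0
          · rw [← pow_succ]; exact mass_le_onesIn h0 h1 S 3
          · rw [mul_one]; exact mass_le_onesIn h0 h1 S 2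
          · exact absurd (hi0 ▸ hi₀) hi
          · rw [mul_one]; exact mass_onesIn_ne_one_le_exp h0 h1 S hS
    _ ≤ (S.card * p) ^ (2 * R.card) * Real.exp (-(S.card * (n * p) / 4)) * (S.card * p) := by
        rw [Finset.prod_mul_distrib, Finset.prod_ite_eq' Finset.univ i₀, if_pos (Finset.mem_univ _)]
        gcongr
        exact prod_rows_le h0 hd hS R hR
    _ = _ := by ring

/-- Union bound over `S` and `R`, with `k ^ k / k! ≤ exp k` absorbing the factorials. Thanks to the
excess, the powers of `n` are matched by powers of `p`. The factor `m + 2 = 1 + k` collects the two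
kinds of excess, `k` bounding the choices of the row with three ones. -/
lemma mass_excessEvent_le (h0 : 0 ≤ p) (h1 : p ≤ 1) (hd : 1 ≤ n * p) (m : ℕ)
    (hk : ((m + 1 : ℕ) : ℝ) * p ≤ 1 / 2) :
    mass (matrixWeight (Fin n) (Fin n) p) (excessEvent n (m + 1)) ≤
      (m + 2) * (Real.exp 2 * (n * p) ^ 2 * Real.exp (-(n * p / 4))) ^ (m + 1) := by
  set k := m + 1 with hkdef
  set d : ℝ := n * p with hddef
  set E : ℝ := Real.exp (-(k * d / 4)) with hE
  have hW : ∀ f, 0 ≤ matrixWeight (Fin n) (Fin n) p f :=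
    prodWeight_nonneg (rowWeight_nonneg h0 h1)
  set P : Finset (Finset (Fin n) × Finset (Fin n)) :=
    Finset.univ.powersetCard k ×ˢ Finset.univ.powersetCard k with hP
  set Q : Finset (Finset (Fin n) × Finset (Fin n)) :=
    Finset.univ.powersetCard k ×ˢ Finset.univ.powersetCard m with hQ
  have hA : mass (matrixWeight (Fin n) (Fin n) p) {f | ∃ S : Finset (Fin n), S.card = k ∧
      (∀ i, onesIn (f i) S ≠ 1) ∧
      ∃ R : Finset (Fin n), R.card = k ∧ ∀ i ∈ R, 2 ≤ onesIn (f i) S} ≤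
      (n.choose k * n.choose k : ℝ) * ((k * p) ^ (2 * k) * E) := by
    calc _ ≤ ∑ SR ∈ P, mass (matrixWeight (Fin n) (Fin n) p)
          {f | (∀ i, onesIn (f i) SR.1 ≠ 1) ∧ ∀ i ∈ SR.2, 2 ≤ onesIn (f i) SR.1} := by
          refine mass_le_sum hW P _ ?_
          rintro f ⟨S, hS, h1, R, hR, h2⟩
          exact ⟨(S, R), by simp [hP, hS, hR], h1, h2⟩
      _ ≤ ∑ SR ∈ P, (k * p) ^ (2 * k) * E := Finset.sum_le_sum fun SR hSR => by
          obtain ⟨hS, hR⟩ : SR.1.card = k ∧ SR.2.card = k := by simpa [hP] using hSR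
          have := mass_rows_le h0 h1 hd SR.1 SR.2 (by rw [hS]; exact hk) (by rw [hS, hR])
          rwa [hS, hR] at this
      _ = _ := by simp [hP]
  have hB : mass (matrixWeight (Fin n) (Fin n) p) {f | ∃ S : Finset (Fin n), S.card = k ∧
      (∀ i, onesIn (f i) S ≠ 1) ∧
      ∃ R : Finset (Fin n), R.card + 1 = k ∧ (∀ i ∈ R, 2 ≤ onesIn (f i) S) ∧
        ∃ i ∈ R, 3 ≤ onesIn (f i) S} ≤
      (n.choose k * n.choose m : ℝ) * (m * ((k * p) ^ (2 * m + 1) * E)) := by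
    calc _ ≤ ∑ SR ∈ Q, mass (matrixWeight (Fin n) (Fin n) p)
          {f | (∀ i, onesIn (f i) SR.1 ≠ 1) ∧ (∀ i ∈ SR.2, 2 ≤ onesIn (f i) SR.1) ∧
            ∃ i ∈ SR.2, 3 ≤ onesIn (f i) SR.1} := by
          refine mass_le_sum hW Q _ ?_
          rintro f ⟨S, hS, h1, R, hR, h2, h3⟩
          have hR : R.card = m := by omega
          exact ⟨(S, R), by simp [hQ, hS, hR], h1, h2, h3⟩
      _ ≤ ∑ SR ∈ Q, m * ((k * p) ^ (2 * m + 1) * E) := Finset.sum_le_sum fun SR hSR => by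
          obtain ⟨hS, hR⟩ : SR.1.card = k ∧ SR.2.card = m := by simpa [hQ] using hSR
          calc _ ≤ ∑ i ∈ SR.2, mass (matrixWeight (Fin n) (Fin n) p)
                {f | (∀ i, onesIn (f i) SR.1 ≠ 1) ∧ (∀ i ∈ SR.2, 2 ≤ onesIn (f i) SR.1) ∧
                  3 ≤ onesIn (f i) SR.1} := by
                refine mass_le_sum hW SR.2 _ ?_
                rintro f ⟨h1, h2, i, hi, h3⟩
                exact ⟨i, hi, h1, h2, h3⟩
            _ ≤ ∑ i ∈ SR.2, (k * p) ^ (2 * m + 1) * E := Finset.sum_le_sum fun i hi => by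
                have := mass_rows_le' h0 h1 hd SR.1 SR.2 (by rw [hS]; exact hk)
                  (by rw [hS, hR]; omega) i hi
                rwa [hS, hR] at this
            _ = _ := by simp [hR]
      _ = _ := by simp [hQ]
  have hsub : mass (matrixWeight (Fin n) (Fin n) p) (excessEvent n k) ≤
      (n.choose k * n.choose k : ℝ) * ((k * p) ^ (2 * k) * E) +
      (n.choose k * n.choose m : ℝ) * (m * ((k * p) ^ (2 * m + 1) * E)) := by
    refine le_trans (le_trans (mass_mono hW ?_) (mass_union_le hW _ _)) (add_le_add hA hB)
    rintro f ⟨S, hS, h1, h | h⟩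
    · exact .inl ⟨S, hS, h1, h⟩
    · exact .inr ⟨S, hS, h1, h⟩
  have hE0 : 0 ≤ E := (Real.exp_pos _).le
  have hd0 : 0 ≤ d := by linarith
  set F : ℝ := (k.factorial : ℝ) with hF
  have hF0 : 0 < F := Nat.cast_pos.2 k.factorial_pos
  have hk0 : (0 : ℝ) < k := by rw [hkdef]; positivity
  have hmk : (m : ℝ) + 1 = k := by rw [hkdef]; push_cast; ring
  have hexp : (k : ℝ) ^ k / F ≤ Real.exp k := Real.pow_div_factorial_le_exp k hk0.le k
  have hsq : ((k : ℝ) ^ k / F) ^ 2 ≤ Real.exp 2 ^ k := by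
    calc ((k : ℝ) ^ k / F) ^ 2 ≤ Real.exp k ^ 2 := by gcongr
      _ = Real.exp 2 ^ k := by
        rw [← Real.exp_nat_mul, ← Real.exp_nat_mul, mul_comm]; push_cast; ring_nf
  have hck : (n.choose k : ℝ) ≤ n ^ k / F := Nat.choose_le_pow_div k n
  have hcm : (n.choose m : ℝ) ≤ n ^ m * k / F := by
    refine (Nat.choose_le_pow_div m n).trans (le_of_eq ?_)
    have hfm : F = k * m.factorial := by
      rw [hF, hkdef, Nat.factorial_succ]; push_cast; ring
    rw [hfm]
    field_simp
  have hEk : E = Real.exp (-(d / 4)) ^ k := by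
    rw [hE, ← Real.exp_nat_mul]; congr 1; ring
  have bA : (n.choose k * n.choose k : ℝ) * ((k * p) ^ (2 * k) * E) ≤
      (Real.exp 2 * d ^ 2 * Real.exp (-(d / 4))) ^ k := by
    calc _ ≤ ((n : ℝ) ^ k / F * (n ^ k / F)) * ((k * p) ^ (2 * k) * E) := by gcongr
      _ = ((k : ℝ) ^ k / F) ^ 2 * (d ^ 2) ^ k * E := by
          rw [hddef]; ring
      _ ≤ Real.exp 2 ^ k * (d ^ 2) ^ k * E := by gcongr
      _ = _ := by rw [hEk]; ring
  have bB : (n.choose k * n.choose m : ℝ) * (m * ((k * p) ^ (2 * m + 1) * E)) ≤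
      k * (Real.exp 2 * d ^ 2 * Real.exp (-(d / 4))) ^ k := by
    calc _ ≤ ((n : ℝ) ^ k / F * (n ^ m * k / F)) * (k * ((k * p) ^ (2 * m + 1) * E)) := by
          gcongr; linarith
      _ = k * (((k : ℝ) ^ k / F) ^ 2 * (d ^ (2 * m + 1)) * E) := by
          rw [hddef, hkdef]; ring
      _ ≤ k * (((k : ℝ) ^ k / F) ^ 2 * (d ^ (2 * k)) * E) := by
          have := pow_le_pow_right₀ hd (show 2 * m + 1 ≤ 2 * k by omega)
          gcongr
      _ = k * (((k : ℝ) ^ k / F) ^ 2 * (d ^ 2) ^ k * E) := by rw [← pow_mul]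
      _ ≤ k * (Real.exp 2 ^ k * (d ^ 2) ^ k * E) := by gcongr
      _ = _ := by rw [hEk]; ring
  calc _ ≤ _ := hsub
    _ ≤ (Real.exp 2 * d ^ 2 * Real.exp (-(d / 4))) ^ k +
        k * (Real.exp 2 * d ^ 2 * Real.exp (-(d / 4))) ^ k := add_le_add bA bB
    _ = _ := by rw [← hmk]; ring

/-- A crude count of `2 ^ n` sets would swamp `(1 - c) ^ n`. Since `S.card ≤ M / p`, inserting a
factor `(c / 2) ^ S.card * exp (L * M / p) ≥ 1` with `L = -log (c / 2)` reduces the count to `(1 + c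
/ 2) ^ n`, up to an exponential whose exponent is `o(n)` as `n * p → ∞`. -/
lemma mass_moderate_le (h0 : 0 < p) (h1 : p ≤ 1 / 2) {M c : ℝ}
    (hc : c = Real.exp (-(2 * M)) / 2) (hM : 0 < M) :
    mass (matrixWeight (Fin n) (Fin n) p) {f | ∃ S : Finset (Fin n), 1 / 2 ≤ S.card * p ∧
      S.card * p ≤ M ∧ ∀ i, onesIn (f i) S ≠ 1} ≤
      ((1 - c / 2) * Real.exp (-Real.log (c / 2) * M / (n * p))) ^ n := by
  have hp1 : p ≤ 1 := by linarith
  have hc0 : 0 < c := by rw [hc]; positivity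
  have hc1 : c ≤ 1 := by
    have : Real.exp (-(2 * M)) ≤ 1 := Real.exp_le_one_iff.2 (by linarith)
    linarith
  rcases Nat.eq_zero_or_pos n with hn | hn
  · subst hn
    rw [pow_zero, ← sum_prodWeight_eq_one (ι := Fin 0) (sum_rowWeight (Fin 0) p), ← mass_univ]
    exact mass_mono (prodWeight_nonneg (rowWeight_nonneg h0.le hp1)) (Set.subset_univ _)
  have hn' : (0 : ℝ) < n := by exact_mod_cast hn
  set L := -Real.log (c / 2) with hL
  have hlog : Real.exp (-L) = c / 2 := by rw [hL, neg_neg, Real.exp_log (by positivity)]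
  have hL0 : 0 ≤ L := by
    rw [hL, neg_nonneg]; exact Real.log_nonpos (by positivity) (by linarith)
  set 𝒮 : Finset (Finset (Fin n)) :=
    Finset.univ.filter fun S => 1 / 2 ≤ (S.card : ℝ) * p ∧ (S.card : ℝ) * p ≤ M with h𝒮
  have hS : ∀ S ∈ 𝒮, mass (matrixWeight (Fin n) (Fin n) p) {f | ∀ i, onesIn (f i) S ≠ 1} ≤
      (c / 2) ^ S.card * Real.exp (L * M / p) * (1 - c) ^ n := by
    intro S hS
    obtain ⟨hS1, hS2⟩ : 1 / 2 ≤ (S.card : ℝ) * p ∧ (S.card : ℝ) * p ≤ M := by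
      simpa only [h𝒮, Finset.mem_filter, Finset.mem_univ, true_and] using hS
    have e := mass_pi (W := rowWeight (Fin n) p) (fun _ : Fin n => {ω | onesIn ω S ≠ 1})
    have hle : mass (matrixWeight (Fin n) (Fin n) p) {f | ∀ i, onesIn (f i) S ≠ 1} ≤
        (1 - c) ^ n := by
      refine (le_of_eq e).trans ?_
      rw [Finset.prod_const, Finset.card_univ, Fintype.card_fin]
      refine pow_le_pow_left₀ (mass_nonneg (rowWeight_nonneg h0.le hp1) _) ?_ n
      rw [hc]
      exact mass_onesIn_ne_one_le_const h0.le h1 S hS1 hS2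
    have hone : 1 ≤ (c / 2) ^ S.card * Real.exp (L * M / p) := by
      rw [← hlog, ← Real.exp_nat_mul, ← Real.exp_add, Real.one_le_exp_iff]
      have : (S.card : ℝ) ≤ M / p := by rwa [le_div_iff₀ h0]
      have := mul_le_mul_of_nonneg_left this hL0
      rw [mul_div_assoc]
      linarith
    have h1c : 0 ≤ (1 - c) ^ n := pow_nonneg (by linarith) n
    calc _ ≤ 1 * (1 - c) ^ n := by rwa [one_mul]
      _ ≤ _ := by gcongr
  calc _ ≤ ∑ S ∈ 𝒮, mass (matrixWeight (Fin n) (Fin n) p) {f | ∀ i, onesIn (f i) S ≠ 1} := by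
        refine mass_le_sum (prodWeight_nonneg (rowWeight_nonneg h0.le hp1)) 𝒮 _ ?_
        rintro f ⟨S, hS1, hS2, h⟩
        exact ⟨S, by simp only [h𝒮, Finset.mem_filter, Finset.mem_univ, true_and]; exact ⟨hS1, hS2⟩,
          h⟩
    _ ≤ ∑ S ∈ 𝒮, (c / 2) ^ S.card * Real.exp (L * M / p) * (1 - c) ^ n := Finset.sum_le_sum hS
    _ ≤ ∑ S : Finset (Fin n), (c / 2) ^ S.card * Real.exp (L * M / p) * (1 - c) ^ n :=
        Finset.sum_le_univ_sum_of_nonneg fun S => by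
          have : 0 ≤ 1 - c := by linarith
          positivity
    _ = (c / 2 + 1) ^ n * Real.exp (L * M / p) * (1 - c) ^ n := by
        rw [← Finset.sum_mul, ← Finset.sum_mul]
        congr 2
        have := Fin.sum_pow_mul_eq_add_pow (n := n) (c / 2) 1
        simpa using this
    _ = ((c / 2 + 1) * (1 - c) * Real.exp (L * M / (n * p))) ^ n := by
        have : Real.exp (L * M / p) = Real.exp (L * M / (n * p)) ^ n := by
          rw [← Real.exp_nat_mul]; congr 1; field_simp
        rw [this, mul_pow, mul_pow]; ring
    _ ≤ _ := by
        have : 0 ≤ 1 - c := by linarith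
        gcongr
        nlinarith

end Small

/-! ### Dependencies on many columns. -/

section Large

variable {n : ℕ} {p : ℝ}

/-- A large dependency on the columns of `S` whose kernel is determined by a set `R` of fewer
than `S.card` rows. -/
def largeEvent (n : ℕ) (p M : ℝ) : Set (Fin n → Fin n → Bool) :=
  {f | ∃ S R : Finset (Fin n), M ≤ S.card * p ∧ 2 * S.card ≤ n ∧ R.card < S.card ∧
    (∃ z : Fin n → ℝ, (∀ j ∈ S, z j ≠ 0) ∧ (∀ j ∉ S, z j = 0) ∧ ∀ i, rowDot (f i) z = 0) ∧
    ∀ z : Fin n → ℝ, (∀ j ∉ S, z j = 0) →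
      (∀ i ∈ R, rowDot (f i) z = 0) → ∀ i, rowDot (f i) z = 0}

lemma mass_largeEvent_le (h0 : 0 ≤ p) (h1 : p ≤ 1) {M : ℝ}
    (hM : ∀ (z : Fin n → ℝ) (s : Finset (Fin n)), (∀ j ∈ s, z j ≠ 0) → M ≤ s.card * p →
      mass (rowWeight (Fin n) p) {ω | rowDot ω z = 0} ≤ 1 / 64) :
    mass (matrixWeight (Fin n) (Fin n) p) (largeEvent n p M) ≤ (1 / 2) ^ n := by
  classical
  have hW := rowWeight_nonneg (κ := Fin n) h0 h1
  -- This set depends on `f` only through the rows in `R`. It is empty unless those rows have a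
  -- common kernel vector with support `S`, and then its rows annihilate that vector.
  set X : Finset (Fin n) → Finset (Fin n) → (Fin n → Fin n → Bool) → Set (Fin n → Bool) :=
    fun S R f => {ω | (∃ z : Fin n → ℝ, (∀ j ∈ S, z j ≠ 0) ∧ (∀ j ∉ S, z j = 0) ∧
        ∀ i ∈ R, rowDot (f i) z = 0) ∧
      ∀ z : Fin n → ℝ, (∀ j ∉ S, z j = 0) → (∀ i ∈ R, rowDot (f i) z = 0) → rowDot ω z = 0}
    with hX
  set P : Finset (Finset (Fin n) × Finset (Fin n)) := Finset.univ.filter fun SR =>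
    M ≤ SR.1.card * p ∧ 2 * SR.1.card ≤ n ∧ SR.2.card < SR.1.card with hP
  have hSR : ∀ SR ∈ P, mass (matrixWeight (Fin n) (Fin n) p)
      {f | ∀ i ∉ SR.2, f i ∈ X SR.1 SR.2 f} ≤ (1 / 8) ^ n := by
    rintro ⟨S, R⟩ hSR
    obtain ⟨hS, hSn, hRS⟩ : M ≤ S.card * p ∧ 2 * S.card ≤ n ∧ R.card < S.card := by
      simpa only [hP, Finset.mem_filter, Finset.mem_univ, true_and] using hSR
    have hle := mass_le_pow_of_dependent hW (sum_rowWeight (Fin n) p) R (X S R)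
      (fun f f' hff => by
        have e : ∀ z : Fin n → ℝ, (∀ i ∈ R, rowDot (f i) z = 0) ↔ ∀ i ∈ R, rowDot (f' i) z = 0 :=
          fun z => forall₂_congr fun i hi => by rw [hff i hi]
        simp only [hX, e])
      (c := 1 / 64) (fun f => by
        by_cases hz : ∃ z : Fin n → ℝ, (∀ j ∈ S, z j ≠ 0) ∧ (∀ j ∉ S, z j = 0) ∧
            ∀ i ∈ R, rowDot (f i) z = 0
        · obtain ⟨z, hz1, hz2, hz3⟩ := hz
          exact (mass_mono hW fun ω hω => hω.2 z hz2 hz3).trans (hM z S hz1 hS)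
        · have : X S R f = ∅ := Set.eq_empty_of_forall_notMem fun ω hω => hz hω.1
          rw [this, mass_empty]; norm_num)
    refine hle.trans ?_
    -- At least `n / 2` rows lie outside `R`, giving `8 ^ (-n)` against the `4 ^ n` pairs; this is
    -- why `1 / 64` is required.
    rw [Fintype.card_fin, show (1 / 64 : ℝ) = (1 / 8) ^ 2 by norm_num, ← pow_mul]
    exact pow_le_pow_of_le_one (by norm_num) (by norm_num) (by omega)
  calc _ ≤ ∑ SR ∈ P, mass (matrixWeight (Fin n) (Fin n) p)
        {f | ∀ i ∉ SR.2, f i ∈ X SR.1 SR.2 f} := by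
        refine mass_le_sum (prodWeight_nonneg hW) P _ ?_
        rintro f ⟨S, R, hS, hSn, hRS, ⟨z, hz1, hz2, hz3⟩, hker⟩
        refine ⟨(S, R), ?_, fun i _ => ⟨⟨z, hz1, hz2, fun i _ => hz3 i⟩,
          fun z hz hzR => hker z hz hzR i⟩⟩
        simp only [hP, Finset.mem_filter, Finset.mem_univ, true_and]
        exact ⟨hS, hSn, hRS⟩
    _ ≤ ∑ SR ∈ P, (1 / 8) ^ n := Finset.sum_le_sum hSR
    _ ≤ ∑ _SR : Finset (Fin n) × Finset (Fin n), (1 / 8 : ℝ) ^ n :=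
        Finset.sum_le_univ_sum_of_nonneg fun _ => by positivity
    _ = (1 / 2) ^ n := by
        rw [Finset.sum_const, Finset.card_univ, Fintype.card_prod, Fintype.card_finset,
          Fintype.card_fin, nsmul_eq_mul]
        push_cast
        rw [← mul_pow, ← mul_pow]
        norm_num

/-- The kernel contains a vector supported on more than half of the columns. -/
def hugeEvent (n : ℕ) : Set (Fin n → Fin n → Bool) :=
  {f | ∃ (S : Finset (Fin n)) (z : Fin n → ℝ), n < 2 * S.card ∧ (∀ j ∈ S, z j ≠ 0) ∧
    ∀ i, rowDot (f i) z = 0}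

/-- It is unlikely that both the kernel and the left kernel contain vectors with large support. -/
lemma mass_hugeEvent_inter_le (h0 : 0 ≤ p) (h1 : p ≤ 1) {ε : ℝ} (hn : 0 < n) (hε : 0 ≤ ε)
    (hM : ∀ (z : Fin n → ℝ) (s : Finset (Fin n)), (∀ j ∈ s, z j ≠ 0) → n < 2 * s.card →
      mass (rowWeight (Fin n) p) {ω | rowDot ω z = 0} ≤ ε) :
    mass (matrixWeight (Fin n) (Fin n) p)
      {f | f ∈ hugeEvent n ∧ (fun i j => f j i) ∈ hugeEvent n} ≤ 2 * ε := by
  classical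
  have hW := rowWeight_nonneg (κ := Fin n) h0 h1
  set X : Fin n → (Fin n → Fin n → Bool) → Set (Fin n → Bool) :=
    fun i₀ f => {ω | (∃ (S : Finset (Fin n)) (z : Fin n → ℝ), n < 2 * S.card ∧
        (∀ j ∈ S, z j ≠ 0) ∧ ∀ i ∈ Finset.univ.erase i₀, rowDot (f i) z = 0) ∧
      ∀ z : Fin n → ℝ, (∀ i ∈ Finset.univ.erase i₀, rowDot (f i) z = 0) → rowDot ω z = 0}
    with hX
  have hi : ∀ i₀, mass (matrixWeight (Fin n) (Fin n) p)
      {f | ∀ i ∉ Finset.univ.erase i₀, f i ∈ X i₀ f} ≤ ε := by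
    intro i₀
    have hle := mass_le_pow_of_dependent hW (sum_rowWeight (Fin n) p) (Finset.univ.erase i₀) (X i₀)
      (fun f f' hff => by
        have e : ∀ z : Fin n → ℝ, (∀ i ∈ Finset.univ.erase i₀, rowDot (f i) z = 0) ↔
            ∀ i ∈ Finset.univ.erase i₀, rowDot (f' i) z = 0 :=
          fun z => forall₂_congr fun i hi => by rw [hff i hi]
        simp only [hX, e])
      (c := ε) (fun f => by
        by_cases hz : ∃ (S : Finset (Fin n)) (z : Fin n → ℝ), n < 2 * S.card ∧
            (∀ j ∈ S, z j ≠ 0) ∧ ∀ i ∈ Finset.univ.erase i₀, rowDot (f i) z = 0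
        · obtain ⟨S, z, hS, hz1, hz2⟩ := hz
          exact (mass_mono hW fun ω hω => hω.2 z hz2).trans (hM z S hz1 hS)
        · have : X i₀ f = ∅ := Set.eq_empty_of_forall_notMem fun ω hω => hz hω.1
          rw [this, mass_empty]; exact hε)
    have e : Fintype.card (Fin n) - (Finset.univ.erase i₀).card = 1 := by
      rw [Finset.card_erase_of_mem (Finset.mem_univ _), Finset.card_univ, Fintype.card_fin]
      omega
    rwa [e, pow_one] at hle
  -- A left kernel vector `y` writes each row in its support as a combination of the others, so that
  -- row kills everything they kill. There are more than `n / 2` such rows, each at cost `ε`.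
  have hkey : (n / 2 : ℝ) * mass (matrixWeight (Fin n) (Fin n) p)
      {f | f ∈ hugeEvent n ∧ (fun i j => f j i) ∈ hugeEvent n} ≤
      ∑ i₀, mass (matrixWeight (Fin n) (Fin n) p)
        {f | ∀ i ∉ Finset.univ.erase i₀, f i ∈ X i₀ f} := by
    refine mul_mass_le_sum (prodWeight_nonneg hW) _ _ ?_
    rintro f ⟨⟨S, z, hS, hz, hker⟩, T, y, hT, hy, hleft⟩
    refine ⟨T, ?_, fun i₀ hi₀ => ?_⟩
    · have : (n : ℝ) < 2 * T.card := by exact_mod_cast hT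
      linarith
    · intro i hii
      have hii : i = i₀ := by simpa using hii
      subst hii
      refine ⟨⟨S, z, hS, hz, fun i _ => hker i⟩, fun w hw => ?_⟩
      have hsum : ∑ l, y l * rowDot (f l) w = 0 := by
        have hj : ∀ j, ∑ l, (if f l j = true then y l else 0) = 0 := hleft
        simp only [rowDot, Finset.mul_sum]
        rw [Finset.sum_comm]
        refine Finset.sum_eq_zero fun j _ => ?_
        calc _ = w j * ∑ l, (if f l j = true then y l else 0) := by
              rw [Finset.mul_sum]
              exact Finset.sum_congr rfl fun l _ => by split_ifs <;> ring
          _ = 0 := by rw [hj, mul_zero]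
      rw [Finset.sum_eq_single i (fun l _ hl => by rw [hw l (by simp [hl]), mul_zero])
        (by simp)] at hsum
      exact (mul_eq_zero.1 hsum).resolve_left (hy i hi₀)
  have h2 : (n / 2 : ℝ) * mass (matrixWeight (Fin n) (Fin n) p)
      {f | f ∈ hugeEvent n ∧ (fun i j => f j i) ∈ hugeEvent n} ≤ (n / 2 : ℝ) * (2 * ε) := by
    refine hkey.trans ((Finset.sum_le_sum fun i _ => hi i).trans (le_of_eq ?_))
    simp
    ring
  have hn' : (0 : ℝ) < n := by exact_mod_cast hn
  exact le_of_mul_le_mul_left h2 (by positivity)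

end Large

/-! ### Assembling the cases and passing to the limit. -/

section Combine

variable {n : ℕ} {p : ℝ}

/-- The union of the unlikely events for dependencies on at most half of the columns. -/
def smallEvent (n : ℕ) (p M : ℝ) : Set (Fin n → Fin n → Bool) :=
  {f | ∃ k ∈ (Finset.range n).filter fun m => ((m + 1 : ℕ) : ℝ) * p ≤ 1 / 2,
    f ∈ excessEvent n (k + 1)} ∪
  ({f | ∃ S : Finset (Fin n), 1 / 2 ≤ S.card * p ∧ S.card * p ≤ M ∧ ∀ i, onesIn (f i) S ≠ 1} ∪
    largeEvent n p M)

lemma mem_smallEvent_or_hugeEvent (f : Fin n → Fin n → Bool) (M : ℝ)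
    (hf : ¬ MinimalDependenciesAreTrees (ofRows f)) : f ∈ smallEvent n p M ∨ f ∈ hugeEvent n := by
  unfold MinimalDependenciesAreTrees at hf
  push Not at hf
  obtain ⟨k, S, hS, hdep, htree⟩ := hf
  have hk : 0 < k := by have := hdep.2.2; omega
  obtain ⟨m, rfl⟩ : ∃ m, k = m + 1 := ⟨k - 1, by omega⟩
  have hkn : m + 1 ≤ n := by simpa [hS] using Finset.card_le_univ S
  obtain ⟨z, hz1, hz2, hz3⟩ := hdep.exists_kernel
  by_cases hn : n < 2 * S.card
  · exact .inr ⟨S, z, hn, hz1, hz3⟩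
  left
  rcases le_or_gt (((m + 1 : ℕ) : ℝ) * p) (1 / 2) with h | h
  · left
    exact ⟨m, Finset.mem_filter.2 ⟨Finset.mem_range.2 (by omega), h⟩, S, hS, hdep.onesIn_ne_one,
      hdep.excess htree⟩
  right
  rw [← hS] at h
  rcases le_or_gt ((S.card : ℝ) * p) M with h' | h'
  · exact .inl ⟨S, h.le, h', hdep.onesIn_ne_one⟩
  · obtain ⟨R, hR, hker⟩ := hdep.exists_rows
    exact .inr ⟨S, R, h'.le, by omega, by omega, ⟨z, hz1, hz2, hz3⟩, hker⟩

lemma sum_mul_pow_succ_le {r : ℝ} (h0 : 0 ≤ r) (h1 : r ≤ 1 / 4) (s : Finset ℕ) (n : ℕ)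
    (hs : s ⊆ Finset.range n) : ∑ m ∈ s, ((m : ℝ) + 2) * r ^ (m + 1) ≤ 4 * r := by
  calc _ ≤ ∑ m ∈ Finset.range n, ((m : ℝ) + 2) * r ^ (m + 1) :=
        Finset.sum_le_sum_of_subset_of_nonneg hs fun _ _ _ => by positivity
    _ ≤ ∑ m ∈ Finset.range n, (2 * r) * (1 / 2) ^ m := Finset.sum_le_sum fun m _ => by
        have h2 : (m : ℝ) + 2 ≤ 2 * 2 ^ m := by
          have : m + 1 ≤ 2 ^ m := Nat.lt_two_pow_self
          have : ((m : ℝ) + 1) ≤ 2 ^ m := by exact_mod_cast this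
          have : (1 : ℝ) ≤ 2 ^ m := one_le_pow₀ (by norm_num)
          linarith
        have h3 : r ^ m ≤ (1 / 4) ^ m := by gcongr
        calc ((m : ℝ) + 2) * r ^ (m + 1) ≤ 2 * 2 ^ m * (r * (1 / 4) ^ m) := by
              rw [pow_succ']; gcongr
          _ = 2 * r * (2 * (1 / 4)) ^ m := by rw [mul_pow]; ring
          _ = _ := by norm_num
    _ = 2 * r * ∑ m ∈ Finset.range n, (1 / 2 : ℝ) ^ m := by rw [Finset.mul_sum]
    _ ≤ 2 * r * 2 := by
        gcongr
        have := (summable_geometric_two).sum_le_tsum (Finset.range n) (fun _ _ => by positivity)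
        rwa [tsum_geometric_two] at this
    _ = _ := by ring

lemma mass_smallEvent_le (h0 : 0 < p) (h1 : p ≤ 1 / 2) (hd : 1 ≤ n * p) {M c : ℝ}
    (hc : c = Real.exp (-(2 * M)) / 2) (hM0 : 0 < M)
    (hr : Real.exp 2 * (n * p) ^ 2 * Real.exp (-(n * p / 4)) ≤ 1 / 4)
    (hM : ∀ (z : Fin n → ℝ) (s : Finset (Fin n)), (∀ j ∈ s, z j ≠ 0) → M ≤ s.card * p →
      mass (rowWeight (Fin n) p) {ω | rowDot ω z = 0} ≤ 1 / 64) :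
    mass (matrixWeight (Fin n) (Fin n) p) (smallEvent n p M) ≤
      4 * (Real.exp 2 * (n * p) ^ 2 * Real.exp (-(n * p / 4))) +
        (((1 - c / 2) * Real.exp (-Real.log (c / 2) * M / (n * p))) ^ n + (1 / 2) ^ n) := by
  have hp1 : p ≤ 1 := by linarith
  have hW : ∀ f, 0 ≤ matrixWeight (Fin n) (Fin n) p f :=
    prodWeight_nonneg (rowWeight_nonneg h0.le hp1)
  refine (mass_union_le hW _ _).trans (add_le_add ?_ ((mass_union_le hW _ _).trans
    (add_le_add (mass_moderate_le h0 h1 hc hM0) (mass_largeEvent_le h0.le hp1 hM))))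
  refine (mass_le_sum hW _ _ fun f hf => hf).trans ((Finset.sum_le_sum fun m hm =>
    mass_excessEvent_le h0.le hp1 hd m (Finset.mem_filter.1 hm).2).trans ?_)
  exact sum_mul_pow_succ_le (by positivity) hr _ n (Finset.filter_subset _ _)

/-- If both alternatives fail, then either one of the two matrices is in the small event, or both
are in the huge one; transposition preserves the law. -/
lemma mass_bad_le (h0 : 0 ≤ p) (h1 : p ≤ 1) (M : ℝ) :
    mass (matrixWeight (Fin n) (Fin n) p) {f | ¬ (MinimalDependenciesAreTrees (ofRows f) ∨
      MinimalDependenciesAreTrees (ofRows fun i j => f j i))} ≤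
    2 * mass (matrixWeight (Fin n) (Fin n) p) (smallEvent n p M) +
      mass (matrixWeight (Fin n) (Fin n) p)
        {f | f ∈ hugeEvent n ∧ (fun i j => f j i) ∈ hugeEvent n} := by
  have hW : ∀ f, 0 ≤ matrixWeight (Fin n) (Fin n) p f :=
    prodWeight_nonneg (rowWeight_nonneg h0 h1)
  calc _ ≤ mass (matrixWeight (Fin n) (Fin n) p)
        ((smallEvent n p M ∪ {f | (fun i j => f j i) ∈ smallEvent n p M}) ∪
          {f | f ∈ hugeEvent n ∧ (fun i j => f j i) ∈ hugeEvent n}) := by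
        refine mass_mono hW fun f hf => ?_
        obtain ⟨ha, hb⟩ := not_or.1 hf
        rcases mem_smallEvent_or_hugeEvent (p := p) f M ha with ha | ha
        · exact .inl (.inl ha)
        rcases mem_smallEvent_or_hugeEvent (p := p) _ M hb with hb | hb
        · exact .inl (.inr hb)
        · exact .inr ⟨ha, hb⟩
    _ ≤ _ := by
        refine (mass_union_le hW _ _).trans (add_le_add_left ((mass_union_le hW _ _).trans ?_) _)
        rw [mass_transpose p, two_mul]

end Combine

/-- With high probability, all minimal dependencies of the columns or all minimal dependencies of
the rows of a sparse Bernoulli matrix are tree dependencies. -/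
theorem tendsto_minimalDependenciesAreTrees (p : ℕ → unitInterval)
    (hp : Tendsto (fun n : ℕ => (n : ℝ) * (p n : ℝ)) atTop atTop)
    (hp_half : ∀ n, (p n : ℝ) ≤ 1 / 2) :
    Tendsto
      (fun n : ℕ => (bernoulliLaw n (p n)).real
        {b | MinimalDependenciesAreTrees (zeroOneMatrix b) ∨
          MinimalDependenciesAreTrees (zeroOneMatrix b).transpose})
      atTop (𝓝 1) := by
  obtain ⟨M, hM0, hM⟩ := mass_rowDot_le (ε := 1 / 64) (by norm_num)
  obtain ⟨c, hc⟩ : ∃ c, c = Real.exp (-(2 * M)) / 2 := ⟨_, rfl⟩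
  have hc0 : 0 < c := by rw [hc]; positivity
  set d : ℕ → ℝ := fun n => (n : ℝ) * (p n : ℝ) with hd
  set r : ℕ → ℝ := fun n => Real.exp 2 * d n ^ 2 * Real.exp (-(d n / 4)) with hr
  set s : ℕ → ℝ := fun n => ((1 - c / 2) * Real.exp (-Real.log (c / 2) * M / d n)) ^ n with hs
  have hrlim : Tendsto r atTop (𝓝 0) := by
    have h1 := (Real.tendsto_pow_mul_exp_neg_atTop_nhds_zero 2).comp
      (hp.atTop_div_const (show (0 : ℝ) < 4 by norm_num))
    have h2 := h1.const_mul (Real.exp 2 * 16)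
    rw [mul_zero] at h2
    refine h2.congr fun n => ?_
    simp only [Function.comp, hr, hd]
    ring
  have hslim : Tendsto s atTop (𝓝 0) := by
    have h1 : Tendsto (fun n => (1 - c / 2) * Real.exp (-Real.log (c / 2) * M / d n)) atTop
        (𝓝 ((1 - c / 2) * Real.exp 0)) :=
      ((Real.continuous_exp.tendsto 0).comp (hp.const_div_atTop _)).const_mul _
    rw [Real.exp_zero, mul_one] at h1
    have hc1 : c ≤ 1 := by
      have : Real.exp (-(2 * M)) ≤ 1 := Real.exp_le_one_iff.2 (by linarith)
      linarith
    have h2 : ∀ᶠ n in atTop, s n ≤ (1 - c / 4) ^ n := by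
      filter_upwards [h1.eventually_le_const (show 1 - c / 2 < 1 - c / 4 by linarith)] with n hn
      refine pow_le_pow_left₀ (mul_nonneg (by linarith) (Real.exp_pos _).le) hn n
    have h3 : Tendsto (fun n : ℕ => (1 - c / 4) ^ n) atTop (𝓝 0) :=
      tendsto_pow_atTop_nhds_zero_of_lt_one (by linarith) (by linarith)
    refine squeeze_zero' (Eventually.of_forall fun n => ?_) h2 h3
    exact pow_nonneg (mul_nonneg (by linarith) (Real.exp_pos _).le) n
  have htlim : Tendsto (fun n => 2 * (4 * r n + (s n + (1 / 2) ^ n))) atTop (𝓝 0) := by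
    have h3 : Tendsto (fun n : ℕ => (1 / 2 : ℝ) ^ n) atTop (𝓝 0) :=
      tendsto_pow_atTop_nhds_zero_of_lt_one (by norm_num) (by norm_num)
    simpa using ((hrlim.const_mul 4).add (hslim.add h3)).const_mul 2
  have hlaw : ∀ n, (bernoulliLaw n (p n)).real
      {b | MinimalDependenciesAreTrees (zeroOneMatrix b) ∨
        MinimalDependenciesAreTrees (zeroOneMatrix b).transpose} =
      1 - mass (matrixWeight (Fin n) (Fin n) (p n)) {f | ¬ (MinimalDependenciesAreTrees (ofRows f) ∨
        MinimalDependenciesAreTrees (ofRows fun i j => f j i))} := by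
    intro n
    rw [bernoulliLaw_real_eq_mass, eq_sub_iff_add_eq, ← sum_prodWeight_eq_one (ι := Fin n)
      (sum_rowWeight (Fin n) (p n)), ← mass_add_compl (W := matrixWeight (Fin n) (Fin n) (p n))
      {f | MinimalDependenciesAreTrees (ofRows f) ∨
        MinimalDependenciesAreTrees (ofRows fun i j => f j i)}]
    rfl
  simp_rw [hlaw]
  rw [show (𝓝 (1 : ℝ)) = 𝓝 (1 - 0) by rw [sub_zero]]
  refine Tendsto.sub tendsto_const_nhds ?_
  rw [Metric.tendsto_nhds]
  intro ε hε
  -- The huge event then costs `2 * (ε / 8)` and the small events at most `ε / 4`. A support larger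
  -- than `n / 2` has mean above `n * p / 2`, hence the threshold `2 * M'` below.
  obtain ⟨M', hM'0, hM'⟩ := mass_rowDot_le (ε := ε / 8) (by positivity)
  filter_upwards [hp.eventually_ge_atTop 1, hp.eventually_ge_atTop (2 * M'),
    hrlim.eventually_le_const (show (0 : ℝ) < 1 / 4 by norm_num),
    htlim.eventually_le_const (show (0 : ℝ) < ε / 4 by positivity)] with n hd1 hdM hr4 ht
  have hp0 : 0 ≤ (p n : ℝ) := (p n).2.1
  have hp1 : (p n : ℝ) ≤ 1 := (p n).2.2
  have hppos : 0 < (p n : ℝ) := by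
    rcases hp0.eq_or_lt with h | h
    · simp only [hd, ← h, mul_zero] at hd1; linarith
    · exact h
  have hn : 0 < n := by
    rcases Nat.eq_zero_or_pos n with h | h
    · simp only [hd, h, Nat.cast_zero, zero_mul] at hd1; linarith
    · exact h
  have h1 := mass_smallEvent_le hppos (hp_half n) hd1 hc hM0 hr4
    fun z s => hM (Fin n) (p n) hp0 (hp_half n) z s
  have h2 := mass_hugeEvent_inter_le hp0 hp1 hn (show 0 ≤ ε / 8 by positivity) fun z s hz hs =>
    hM' (Fin n) (p n) hp0 (hp_half n) z s hz (by
      have : (n : ℝ) < 2 * s.card := by exact_mod_cast hs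
      nlinarith)
  have h3 := mass_bad_le (n := n) hp0 hp1 M
  rw [Real.dist_eq, sub_zero, abs_of_nonneg (mass_nonneg
    (prodWeight_nonneg (rowWeight_nonneg hp0 hp1)) _)]
  simp only [hr, hs, hd] at ht
  linarith

end

end SparseRank

theorem theorem4 (p : ℕ → unitInterval)
    (hp : Tendsto (fun n : ℕ => (n : ℝ) * (p n : ℝ)) atTop atTop)
    (hp_half : ∀ n, (p n : ℝ) ≤ 1 / 2) :
    Tendsto
      (fun n : ℕ => (SparseRank.bernoulliLaw n (p n)).real
        {b | SparseRank.MinimalDependenciesAreTrees (SparseRank.zeroOneMatrix b) ∨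
          SparseRank.MinimalDependenciesAreTrees (SparseRank.zeroOneMatrix b).transpose})
      atTop (𝓝 1) := by
  exact SparseRank.tendsto_minimalDependenciesAreTrees p hp hp_half
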